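/- **Notation.** Let $n\ge 0$, $\hat{\mathcal O}_n=\mathbb C[[x_1,\dots,x_n]]$ with maximal ideal $\mathfrak m$, and let $\hat K_n$ be its field of fractions. A formal diffeomorphism is an $n$-tuple $\varphi\in\mathfrak m^n$ with invertible linear part $j^1\varphi$; these form a group $\widehat{\mathrm{Diff}}(\mathbb C^n,0)$ under composition, and $\varphi$ acts on $\hat{\mathcal O}_n$ and $\hat K_n$ by $g\mapsto g\circ\varphi$. Write $\varphi_k\in \mathrm{GL}(\mathfrak m/\mathfrak m^{k+1})$ for the induced map, and $D_k$ for the group of all $\varphi_k$. We call $\varphi$ unipotent if $j^1\varphi-\mathrm{Id}$ is nilpotent. A formal vector field is a $\mathbb C$-derivation $Z$ of $\hat{\mathcal O}_n$ with $Z(\mathfrak m)\subset\mathfrak m$; it induces $Z_k\in \mathrm{End}(\mathfrak m/\mathfrak m^{k+1})$. Let $\hat{\mathfrak X}$ be the Lie algebra of formal vector fields and $\hat K_n\hat{\mathfrak X}$ the $\hat K_n$-vector space that they span inside the derivations of $\hat K_n$. For $Z\in\hat K_n\hat{\mathfrak X}$ put $(\varphi^*Z)(g)=Z(g\circ\varphi^{-1})\circ\varphi$.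 For a subgroup $G$ of $\widehat{\mathrm{Diff}}(\mathbb C^n,0)$ let $G_k$ be the smallest algebraic subgroup of $D_k$ containing $\{\varphi_k:\varphi\in G\}$, and let $\overline G^{(0)}=\{\varphi:\varphi_k\in G_k\ \forall k\}$ be the pro-algebraic closure of $G$; $G$ is pro-algebraic if $G=\overline G^{(0)}$. The Lie algebra of $\overline G^{(0)}$ is $\{Z\in\hat{\mathfrak X}: Z_k\in \mathrm{Lie}(G_k)\ \forall k\}$. The closed derived group $\overline G^{(1)}$ is the closure of $[\overline G^{(0)},\overline G^{(0)}]$ in the Krull topology: $\varphi\in\overline G^{(1)}$ if and only if for every $k$ some element $\eta$ of $[\overline G^{(0)},\overline G^{(0)}]$ satisfies $\eta_k=\varphi_k$. **Lemma.** Let $L$ be a solvable pro-algebraic subgroup of $\widehat{\mathrm{Diff}}(\mathbb C^n,0)$. Let $L_u$ be the normal subgroup of its unipotent elements, $L_{k,u}$ the group of unipotent elements of $L_k$, and $\mathfrak l_N=\{Z\in\hat{\mathfrak X}: Z_k\in\mathrm{Lie}(L_{k,u})\ \forall k\}$ the Lie algebra of $L_u$. Let $a,b\ge 0$, let $B=\{Y_1,\dots,Y_a,X_1,\dots,X_b\}$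 be a set of $a+b$ elements of $\hat K_n\hat{\mathfrak X}$ that are linearly independent over $\hat K_n$, and let $\mathfrak l'$ be the $\hat K_n$-vector space generated by $Y_1,\dots,Y_a$. Suppose that 1. $\mathfrak l_N$ is contained in the $\hat K_n$-vector space generated by $B$; 2. $[Z,W]\in\mathfrak l'$ for all $Z,W\in B$; 3. every element $\alpha_1Y_1+\dots+\alpha_aY_a+\beta_1X_1+\dots+\beta_bX_b$ of $\mathfrak l_N$ (with $\alpha_i,\beta_j\in\hat K_n$) satisfies $Y_k(\beta_j)=X_l(\beta_j)=0$ and $\beta_j\circ\varphi=\beta_j$ for all $1\le j,l\le b$, $1\le k\le a$ and $\varphi\in L$; 4. $\varphi^*Y_k\in\mathfrak l'$ and $\varphi^*X_j-X_j\in\mathfrak l'$ for all $\varphi\in L$, $1\le k\le a$ and $1\le j\le b$; 5. $L/L_u$ is cyclic or a finite abelian group. Then $\overline L^{(1)}$ is a unipotent group (all of its elements are unipotent), and its Lie algebra is contained in $\mathfrak l'\cap\mathfrak l_N$. -/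

import Mathlib

noncomputable section

namespace FormalDynamics

open MvPowerSeries

/-! ### Formal power series, formal diffeomorphisms, formal vector fields -/

/-- The ring of formal power series in `n` variables with complex coefficients. -/
abbrev PS (n : ℕ) := MvPowerSeries (Fin n) ℂ

instance (n : ℕ) : IsDomain (PS n) := NoZeroDivisors.to_isDomain _

/-- The field of fractions of the ring of formal power series. -/
abbrev MeroField (n : ℕ) := FractionRing (PS n)

/-- The group of formal diffeomorphisms of `(ℂⁿ, 0)`, viewed as operators on functions: the formal
diffeomorphism with components `g₁, …, gₙ` is the `ℂ`-algebra automorphism `f ↦ f(g₁, …, gₙ)`,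
and `gᵢ = φ (X i)`. Every `ℂ`-algebra automorphism of the ring of formal power series is
of this form (it preserves the maximal ideal, and see `coeff_apply`). The product is composition of
operators, so the group law is the opposite of composition of maps; none of the notions below
(subgroups, closures, commutator subgroups, quotients, Lie algebras) is sensitive to this. -/
abbrev FormalDiff (n : ℕ) := PS n ≃ₐ[ℂ] PS n

/-- The Lie algebra of (singular) formal vector fields: derivations preserving the maximal ideal. -/
def formalVF (n : ℕ) : LieSubalgebra ℂ (Derivation ℂ (PS n) (PS n)) where
  carrier := {Z | ∀ f : PS n, constantCoeff f = 0 → constantCoeff (Z f) = 0}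
  add_mem' := by
    intro Z W hZ hW f hf
    simp [hZ f hf, hW f hf]
  zero_mem' := by
    intro f _
    simp
  smul_mem' := by
    intro c Z hZ f hf
    simp [hZ f hf]
  lie_mem' := by
    intro Z W hZ hW f hf
    simp [Derivation.commutator_apply, hZ _ (hW f hf), hW _ (hZ f hf)]

/-! ### Jets -/

/-- The exponents of the monomials of degree between `1` and `k`; these monomials form a basis of
`𝔪 / 𝔪ᵏ⁺¹`. -/
abbrev JetIndex (n k : ℕ) := {d : Fin n →₀ ℕ // d ≠ 0 ∧ d.degree ≤ k}

instance (n k : ℕ) : Fintype (JetIndex n k) :=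
  have : Finite (JetIndex n k) :=
    ((Finsupp.finite_of_degree_le (σ := Fin n) k).subset (fun _ h => h.2)).to_subtype
  Fintype.ofFinite _

/-- The matrix, in the basis of monomials, of the operator induced on `𝔪 / 𝔪ᵏ⁺¹` by a linear
operator `T` on formal power series (which preserves the powers of `𝔪`). -/
def jetMatrix {n : ℕ} (k : ℕ) (T : PS n →ₗ[ℂ] PS n) :
    Matrix (JetIndex n k) (JetIndex n k) ℂ :=
  Matrix.of fun e d => coeff e.1 (T (monomial d.1 1))

/-- A formal diffeomorphism preserves the maximal ideal. -/
theorem constantCoeff_apply {n : ℕ} (φ : FormalDiff n) {f : PS n} (hf : constantCoeff f = 0) :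
    constantCoeff (φ f) = 0 := by
  by_contra h
  have h1 : IsUnit (φ f) := MvPowerSeries.isUnit_iff_constantCoeff.2 (isUnit_iff_ne_zero.2 h)
  have h2 : IsUnit f := by simpa using h1.map φ.symm
  have h3 := MvPowerSeries.isUnit_iff_constantCoeff.1 h2
  rw [hf] at h3
  exact not_isUnit_zero h3

theorem exists_sum_X_mul {n m : ℕ} (f : PS n) (hf : ∀ d : Fin n →₀ ℕ, d.degree < m + 1 →
    coeff d f = 0) : ∃ g : Fin n → PS n, (∀ i, ∀ d : Fin n →₀ ℕ, d.degree < m →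
      coeff d (g i) = 0) ∧ f = ∑ i, X i * g i := by
  classical
  have hne : ∀ d : Fin n →₀ ℕ, d ≠ 0 → ∃ i, d i ≠ 0 := fun d hd => by
    by_contra! h
    exact hd (Finsupp.ext h)
  let p : (Fin n →₀ ℕ) → Fin n → Prop := fun d i => ∃ h : d ≠ 0, (hne d h).choose = i
  let g : Fin n → PS n := fun i d =>
    if p (d + Finsupp.single i 1) i then coeff (d + Finsupp.single i 1) f else 0
  have hg : ∀ i d, coeff d (g i) =
    if p (d + Finsupp.single i 1) i then coeff (d + Finsupp.single i 1) f else 0 :=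
      fun i d => rfl
  refine ⟨g, fun i d hd => ?_, ?_⟩
  · rw [hg, hf _ (by simpa [map_add] using hd), ite_self]
  · ext e
    rw [map_sum]
    have key : ∀ i, coeff e (X i * g i) = if p e i then coeff e f else 0 := by
      intro i
      rw [X, coeff_monomial_mul]
      by_cases hle : Finsupp.single i 1 ≤ e
      · rw [if_pos hle, hg, one_mul, tsub_add_cancel_of_le hle]
      · rw [if_neg hle, if_neg]
        rintro ⟨h0, h1⟩
        apply hle
        rw [Finsupp.single_le_iff, ← h1]
        exact Nat.one_le_iff_ne_zero.2 (hne e h0).choose_spec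
    simp_rw [key]
    by_cases he : e = 0
    · subst he
      rw [hf 0 (by simp)]
      simp
    · rw [Finset.sum_eq_single (hne e he).choose]
      · rw [if_pos ⟨he, rfl⟩]
      · intro i _ hi
        rw [if_neg]
        rintro ⟨h0, h1⟩
        exact hi h1.symm
      · simp

/-- A formal diffeomorphism preserves the powers of the maximal ideal. -/
theorem coeff_apply_eq_zero {n : ℕ} (φ : FormalDiff n) (m : ℕ) : ∀ f : PS n,
    (∀ d : Fin n →₀ ℕ, d.degree < m → coeff d f = 0) →
    ∀ d : Fin n →₀ ℕ, d.degree < m → coeff d (φ f) = 0 := by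
  induction m with
  | zero => intro f _ d hd; exact absurd hd (Nat.not_lt_zero _)
  | succ m ih =>
    intro f hf d hd
    obtain ⟨g, hg, rfl⟩ := exists_sum_X_mul f hf
    rw [map_sum, map_sum]
    refine Finset.sum_eq_zero fun i _ => ?_
    rw [map_mul]
    apply coeff_of_lt_order
    have h1 : (1 : ℕ∞) ≤ (φ (X i)).order :=
      one_le_order_iff_constCoeff_eq_zero.2 (constantCoeff_apply φ (by simp))
    have h2 : (m : ℕ∞) ≤ (φ (g i)).order := nat_le_order (ih (g i) (hg i))
    refine lt_of_lt_of_le ?_ le_order_mul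
    refine lt_of_lt_of_le ?_ (add_le_add h1 h2)
    have : d.degree < 1 + m := by omega
    exact_mod_cast this

/-- `f ∘ φ = ∑ f_d g^d` for `g^d = φ (x^d)`: the coefficients of degree at most `k` of `φ f`. -/
theorem coeff_apply {n k : ℕ} (φ : FormalDiff n) (f : PS n) (hf : constantCoeff f = 0)
    (e : Fin n →₀ ℕ) (he : e.degree ≤ k) :
    coeff e (φ f) = ∑ d : JetIndex n k, coeff d.1 f * coeff e (φ (monomial d.1 1)) := by
  classical
  set p : PS n := ∑ d : JetIndex n k, (coeff d.1 f) • monomial d.1 (1 : ℂ) with hp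
  have h : coeff e (φ (f - p)) = 0 := by
    refine coeff_apply_eq_zero φ (k + 1) (f - p) (fun d hd => ?_) e (by omega)
    rw [map_sub, sub_eq_zero, hp, map_sum]
    by_cases h0 : d = 0
    · subst h0
      rw [coeff_zero_eq_constantCoeff_apply, hf]
      symm
      refine Finset.sum_eq_zero fun c _ => ?_
      rw [map_smul, coeff_monomial, if_neg (fun h => c.2.1 h.symm), smul_zero]
    · rw [Finset.sum_eq_single (⟨d, h0, by omega⟩ : JetIndex n k)]
      · simp
      · intro c _ hc
        rw [map_smul, coeff_monomial, if_neg (fun h => hc (Subtype.ext h.symm)), smul_zero]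
      · simp
  rw [map_sub, map_sub, sub_eq_zero] at h
  rw [h, hp, map_sum, map_sum]
  simp

/-- The `k`-jet `φ ↦ φ_k` of a formal diffeomorphism: the action on `𝔪 / 𝔪ᵏ⁺¹`, written in the
basis of monomials. -/
def jet {n : ℕ} (k : ℕ) : FormalDiff n →* GL (JetIndex n k) ℂ :=
  MonoidHom.toHomUnits
    { toFun := fun φ => jetMatrix k φ.toLinearMap
      map_one' := by
        classical
        ext e d
        simp [jetMatrix, coeff_monomial, Matrix.one_apply, Subtype.ext_iff]
      map_mul' := by
        intro φ ψ
        ext e d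
        rw [Matrix.mul_apply]
        have h := coeff_apply φ (ψ (monomial d.1 1))
          (constantCoeff_apply ψ (by
            classical
            rw [← coeff_zero_eq_constantCoeff_apply, coeff_monomial,
              if_neg (fun h => d.2.1 h.symm)])) e.1 e.2.2
        simp only [jetMatrix, Matrix.of_apply, AlgEquiv.toLinearMap_apply, AlgEquiv.mul_apply]
        rw [h]
        exact Finset.sum_congr rfl fun c _ => mul_comm _ _ }

/-! ### Algebraic matrix groups and pro-algebraic groups of formal diffeomorphisms -/

/-- A subgroup of `GL` is algebraic if it is the set of common zeros in `GL` of a family of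
polynomials in the matrix entries. -/
def IsAlgebraic {ι : Type*} [Fintype ι] [DecidableEq ι] (H : Subgroup (GL ι ℂ)) : Prop :=
  ∃ S : Set (MvPolynomial (ι × ι) ℂ), ∀ h : GL ι ℂ,
    h ∈ H ↔ ∀ P ∈ S, MvPolynomial.eval (fun ij => (h : Matrix ι ι ℂ) ij.1 ij.2) P = 0

/-- The Lie algebra of a closed subgroup `S` of the complex group `GL`: all matrices whose complex
one-parameter group is contained in `S`. -/
def matrixLie {ι : Type*} [Fintype ι] [DecidableEq ι] (S : Set (GL ι ℂ)) : Set (Matrix ι ι ℂ) :=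
  {A | ∀ t : ℂ, ∃ h ∈ S, (h : Matrix ι ι ℂ) = NormedSpace.exp (t • A)}

/-- `G_k`: the smallest algebraic subgroup of `D_k = {φ_k}` that contains the `k`-jets of the
elements of `G`. -/
def jetHull {n : ℕ} (G : Subgroup (FormalDiff n)) (k : ℕ) : Subgroup (GL (JetIndex n k) ℂ) :=
  sInf {H | IsAlgebraic H ∧ H ≤ (jet k).range ∧ G.map (jet k) ≤ H}

/-- `G_{k,u}`: the set of unipotent elements of `G_k`. -/
def jetHullUnipotent {n : ℕ} (G : Subgroup (FormalDiff n)) (k : ℕ) :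
    Set (GL (JetIndex n k) ℂ) :=
  {h | h ∈ jetHull G k ∧ IsNilpotent ((h : Matrix (JetIndex n k) (JetIndex n k) ℂ) - 1)}

/-- The pro-algebraic closure of `G`: all `φ` with `φ_k ∈ G_k` for every `k`. -/
def proAlgClosure {n : ℕ} (G : Subgroup (FormalDiff n)) : Subgroup (FormalDiff n) :=
  ⨅ k : ℕ, (jetHull G k).comap (jet k)

/-- `G` is pro-algebraic if it is equal to its pro-algebraic closure. -/
def IsProAlgebraic {n : ℕ} (G : Subgroup (FormalDiff n)) : Prop :=
  G = proAlgClosure G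

/-- The closure of a subgroup in the Krull topology: all `φ` such that for every `k` there is an
element of `G` with the same `k`-jet as `φ`. -/
def krullClosure {n : ℕ} (G : Subgroup (FormalDiff n)) : Subgroup (FormalDiff n) :=
  ⨅ k : ℕ, (G.map (jet k)).comap (jet k)

/-- The closed derived series of `G`. -/
def closedDerived {n : ℕ} (G : Subgroup (FormalDiff n)) : ℕ → Subgroup (FormalDiff n)
  | 0 => proAlgClosure G
  | j + 1 => krullClosure ⁅closedDerived G j, closedDerived G j⁆

/-- The Jacobian matrix at the origin, i.e. the linear part. -/
def linearPart {n : ℕ} (φ : FormalDiff n) : Matrix (Fin n) (Fin n) ℂ :=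
  Matrix.of fun i j => coeff (Finsupp.single j 1) (φ (X i))

/-- A formal diffeomorphism is unipotent if its linear part is unipotent. -/
def IsUnipotent {n : ℕ} (φ : FormalDiff n) : Prop :=
  IsNilpotent (linearPart φ - 1)

/-- The normal subgroup of `G` generated by the set `G_u` of unipotent elements of `G`. If `G` is
solvable, then `G_u` is itself a normal subgroup of `G`, so that this is `G_u`. -/
def unipotentPart {n : ℕ} (G : Subgroup (FormalDiff n)) : Subgroup G :=
  Subgroup.normalClosure {φ : G | IsUnipotent (φ : FormalDiff n)}

instance {n : ℕ} (G : Subgroup (FormalDiff n)) : (unipotentPart G).Normal :=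
  Subgroup.normalClosure_normal

/-- The Lie algebra of (the pro-algebraic closure of) `G`: all formal vector fields `Z` such that
`Z_k` is in the Lie algebra of `G_k` for every `k`. -/
def lieAlg {n : ℕ} (G : Subgroup (FormalDiff n)) : Set (Derivation ℂ (PS n) (PS n)) :=
  {Z | Z ∈ formalVF n ∧
    ∀ k : ℕ, jetMatrix k (Z : PS n →ₗ[ℂ] PS n) ∈ matrixLie (jetHull G k : Set (GL (JetIndex n k) ℂ))}

/-- The Lie algebra of the unipotent part of (the pro-algebraic closure of) a solvable group `G`:
all formal vector fields `Z` such that `Z_k` is in the Lie algebra of `G_{k,u}` for every `k`. -/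
def lieAlgUnipotent {n : ℕ} (G : Subgroup (FormalDiff n)) : Set (Derivation ℂ (PS n) (PS n)) :=
  {Z | Z ∈ formalVF n ∧
    ∀ k : ℕ, jetMatrix k (Z : PS n →ₗ[ℂ] PS n) ∈ matrixLie (jetHullUnipotent G k)}

/-! ### Formal meromorphic vector fields -/

theorem exists_eq_div {A K : Type*} [CommRing A] [IsDomain A] [Field K] [Algebra A K]
    [IsFractionRing A K] (x : K) : ∃ a b : A, algebraMap A K b ≠ 0 ∧
    x * algebraMap A K b = algebraMap A K a := by
  obtain ⟨a, b, hb, rfl⟩ := IsFractionRing.div_surjective A x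
  have hb' : algebraMap A K b ≠ 0 := fun h =>
    nonZeroDivisors.ne_zero hb (IsFractionRing.injective A K (by simpa using h))
  exact ⟨a, b, hb', div_mul_cancel₀ _ hb'⟩

section FractionField

variable {A K : Type*} [CommRing A] [IsDomain A] [Algebra ℂ A] [Field K] [Algebra A K]
  [IsFractionRing A K]

/-- The value at `z = a / b` of the extension of a derivation by the quotient rule. -/
def quotientRule (Z : Derivation ℂ A A) (z : K) : K :=
  let s := IsLocalization.sec (nonZeroDivisors A) z
  (algebraMap A K s.2 * algebraMap A K (Z s.1) - algebraMap A K s.1 * algebraMap A K (Z s.2))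
    / algebraMap A K s.2 ^ 2

theorem quotientRule_eq (Z : Derivation ℂ A A) (z : K) (a b : A)
    (hb : algebraMap A K b ≠ 0) (hz : z * algebraMap A K b = algebraMap A K a) :
    quotientRule Z z = (algebraMap A K b * algebraMap A K (Z a)
      - algebraMap A K a * algebraMap A K (Z b)) / algebraMap A K b ^ 2 := by
  have hinj := IsFractionRing.injective A K
  have hs := IsLocalization.sec_spec (nonZeroDivisors A) z
  unfold quotientRule
  set s := IsLocalization.sec (nonZeroDivisors A) z
  obtain ⟨c, d, hd⟩ := s
  simp only at hs ⊢
  have hd' : algebraMap A K d ≠ 0 :=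
    fun h => nonZeroDivisors.ne_zero hd (hinj (by simpa using h))
  have hcross : c * b = a * d := by
    apply hinj
    rw [map_mul, map_mul, ← hs, ← hz]
    ring
  have hder : b * Z c + c * Z b = d * Z a + a * Z d := by
    have h := congrArg Z hcross
    rw [Derivation.leibniz, Derivation.leibniz, smul_eq_mul, smul_eq_mul, smul_eq_mul,
      smul_eq_mul] at h
    linear_combination h
  rw [div_eq_div_iff (pow_ne_zero 2 hd') (pow_ne_zero 2 hb)]
  simp only [← map_mul, ← map_sub, ← map_pow]
  congr 1
  linear_combination (b * d) * hder - (b * Z d + d * Z b) * hcross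

/-- The extension of a derivation of a domain to its field of fractions. -/
def extendDerivation (K : Type*) [Field K] [Algebra A K] [IsFractionRing A K] [Algebra ℂ K]
    [IsScalarTower ℂ A K] (Z : Derivation ℂ A A) : Derivation ℂ K K :=
  Derivation.mk'
    { toFun := quotientRule Z
      map_add' := by
        intro x y
        obtain ⟨a, b, hb, hx⟩ := exists_eq_div (A := A) x
        obtain ⟨c, d, hd, hy⟩ := exists_eq_div (A := A) y
        rw [quotientRule_eq Z x a b hb hx, quotientRule_eq Z y c d hd hy,
          quotientRule_eq Z (x + y) (a * d + c * b) (b * d)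
            (by rw [map_mul]; exact mul_ne_zero hb hd)
            (by rw [map_mul, map_add, map_mul, map_mul, ← hx, ← hy]; ring)]
        simp only [map_add, Derivation.leibniz, smul_eq_mul, map_mul]
        field_simp
        ring
      map_smul' := by
        intro r x
        obtain ⟨a, b, hb, hx⟩ := exists_eq_div (A := A) x
        have hr : ∀ f : A, algebraMap A K (r • f) = r • algebraMap A K f := fun f =>
          (IsScalarTower.toAlgHom ℂ A K).toLinearMap.map_smul r f
        rw [quotientRule_eq Z x a b hb hx,
          quotientRule_eq Z _ (r • a) b hb (by rw [hr, smul_mul_assoc, hx])]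
        rw [Derivation.map_smul, hr, hr, RingHom.id_apply, mul_smul_comm, smul_mul_assoc,
          ← smul_sub, smul_div_assoc] }
    (by
      intro x y
      obtain ⟨a, b, hb, hx⟩ := exists_eq_div (A := A) x
      obtain ⟨c, d, hd, hy⟩ := exists_eq_div (A := A) y
      simp only [LinearMap.coe_mk, AddHom.coe_mk]
      rw [quotientRule_eq Z x a b hb hx, quotientRule_eq Z y c d hd hy,
        quotientRule_eq Z (x * y) (a * c) (b * d)
          (by rw [map_mul]; exact mul_ne_zero hb hd)
          (by rw [map_mul, map_mul, ← hx, ← hy]; ring)]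
      simp only [Derivation.leibniz, smul_eq_mul, map_mul, map_add]
      rw [eq_div_of_mul_eq hb hx, eq_div_of_mul_eq hd hy]
      field_simp
      ring)

theorem extendDerivation_algebraMap [Algebra ℂ K] [IsScalarTower ℂ A K] (Z : Derivation ℂ A A)
    (f : A) : extendDerivation K Z (algebraMap A K f) = algebraMap A K (Z f) := by
  change quotientRule Z _ = _
  rw [quotientRule_eq Z _ f 1 (by simp) (by simp)]
  simp

end FractionField

/-- The extension of a derivation of the ring of formal power series to its field of fractions. -/
abbrev extend {n : ℕ} (Z : Derivation ℂ (PS n) (PS n)) :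
    Derivation ℂ (MeroField n) (MeroField n) :=
  extendDerivation (MeroField n) Z

/-- The space of formal meromorphic vector fields: the vector space over the field of fractions
that is spanned by the formal vector fields (inside the derivations of the field). -/
def meroVF (n : ℕ) : Submodule (MeroField n) (Derivation ℂ (MeroField n) (MeroField n)) :=
  Submodule.span (MeroField n) (extend '' (formalVF n : Set (Derivation ℂ (PS n) (PS n))))

/-- The action `g ↦ g ∘ φ` of a formal diffeomorphism on the field of fractions. -/
def fieldAct {n : ℕ} (φ : FormalDiff n) : MeroField n ≃ₐ[ℂ] MeroField n :=
  IsFractionRing.algEquivOfAlgEquiv φ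

/-- The pull-back `φ^* Z` of a meromorphic vector field: `(φ^* Z)(g) = Z(g ∘ φ⁻¹) ∘ φ`. -/
def pullback {n : ℕ} (φ : FormalDiff n) (Z : Derivation ℂ (MeroField n) (MeroField n)) :
    Derivation ℂ (MeroField n) (MeroField n) :=
  Derivation.mk'
    ((fieldAct φ).toLinearMap ∘ₗ (Z : MeroField n →ₗ[ℂ] MeroField n) ∘ₗ
      (fieldAct φ).symm.toLinearMap)
    (by
      intro f g
      simp [Derivation.leibniz])

end FormalDynamics

end

open FormalDynamics

noncomputable section

namespace FormalDynamics

open MvPowerSeries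

/-! Membership of a formal vector field in `𝔩'` is a linear condition. Clearing denominators in the
equations of `𝔩'` gives tuples `c` of power series such that `Z ∈ 𝔩'` iff `∑ c_i Z(x_i) = 0` for all
`c` (`extend_mem_of_annihilator`). Each coefficient of such a sum is a linear functional `Λ` on a
space of jets (`jetFunctional`), so it suffices that every `Λ` vanishes on the Lie algebra of the
closed derived group.

Write `Z ∈ 𝔩_N` as `∑ α_i Y_i + ∑ β_j X_j`. Since `L` fixes the `β_j`, preserves `𝔩'` and fixes the
`X_j` modulo `𝔩'`, the difference `φ^*Z - Z` lies in `𝔩'`. Hence each `Λ` is invariant under `L` on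
logarithms of unipotent elements of `L`. An invariant functional is additive on logarithms
(`linearMap_unipotentLog_exp_mul`), so `u ↦ Λ (log u)` is a homomorphism `L_u → ℂ` invariant under
conjugation by `L`. If `K` is its kernel, then `L_u / K` is central in `L / K`. As `L / L_u` is
cyclic, or finite abelian with `ℂ` torsion-free, `L / K` is abelian (`commutator_mem_and_eq_zero`).
Thus `[L, L]` lies in `L_u` and `Λ ∘ log` vanishes on it.

On matrices of bounded size, both unipotency and the vanishing of `Λ ∘ log` are polynomial
conditions, so they pass to the Zariski closure of the jets of `[L, L]`. That closure consists of
jets of formal diffeomorphisms (`mem_range_jet`), so it contains the algebraic hull of the jets of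
the closed derived group. If `exp (t A)` stays in it, then differentiating `Λ (log (exp (t A))) = 0`
at `t = 0` gives `Λ A = 0`.

Two supporting facts are used. A unipotent formal diffeomorphism has complex powers, obtained by
interpolating its iterates polynomially, and these remain in a pro-algebraic group. The unipotent
elements of the solvable group `L` form a subgroup: the complex powers make their linear parts a
connected set, to which the Lie–Kolchin theorem applies. -/

/-! ### Polynomial functions of one variable -/

/-- Two polynomials that agree on the natural numbers are equal. -/
theorem polynomial_eq_of_eval_natCast {p q : Polynomial ℂ}
    (h : ∀ n : ℕ, p.eval (n : ℂ) = q.eval (n : ℂ)) : p = q := by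
  refine Polynomial.eq_of_infinite_eval_eq p q ?_
  refine (Set.infinite_range_of_injective (Nat.cast_injective (R := ℂ))).mono ?_
  rintro _ ⟨n, rfl⟩
  exact h n

/-- A function on `ℂ` given by a polynomial. -/
def PolyFun (F : ℂ → ℂ) : Prop := ∃ p : Polynomial ℂ, ∀ t, F t = p.eval t

namespace PolyFun

theorem eval (p : Polynomial ℂ) : PolyFun fun t => p.eval t := ⟨p, fun _ => rfl⟩

theorem const (c : ℂ) : PolyFun fun _ => c := ⟨Polynomial.C c, fun _ => by simp⟩

theorem add {F G : ℂ → ℂ} (hF : PolyFun F) (hG : PolyFun G) : PolyFun fun t => F t + G t := by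
  obtain ⟨p, hp⟩ := hF
  obtain ⟨q, hq⟩ := hG
  exact ⟨p + q, fun t => by simp [hp, hq]⟩

theorem mul {F G : ℂ → ℂ} (hF : PolyFun F) (hG : PolyFun G) : PolyFun fun t => F t * G t := by
  obtain ⟨p, hp⟩ := hF
  obtain ⟨q, hq⟩ := hG
  exact ⟨p * q, fun t => by simp [hp, hq]⟩

theorem sum {α : Type*} (s : Finset α) {F : α → ℂ → ℂ} (hF : ∀ i, PolyFun (F i)) :
    PolyFun fun t => ∑ i ∈ s, F i t := by
  choose p hp using hF
  exact ⟨∑ i ∈ s, p i, fun t => by simp [hp, Polynomial.eval_finsetSum]⟩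

theorem add_const {F : ℂ → ℂ} (hF : PolyFun F) (c : ℂ) : PolyFun fun t => F (t + c) := by
  obtain ⟨p, hp⟩ := hF
  exact ⟨p.comp (Polynomial.X + Polynomial.C c), fun t => by simp [hp]⟩

theorem const_add {F : ℂ → ℂ} (hF : PolyFun F) (c : ℂ) : PolyFun fun t => F (c + t) := by
  simpa only [add_comm] using hF.add_const c

/-- The principle behind every passage from natural to complex exponents: an identity known for
iterates holds for all `t` once both sides are polynomial in `t`. -/
theorem ext {F G : ℂ → ℂ} (hF : PolyFun F) (hG : PolyFun G) (h : ∀ n : ℕ, F n = G n) (t : ℂ) :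
    F t = G t := by
  obtain ⟨p, hp⟩ := hF
  obtain ⟨q, hq⟩ := hG
  have hpq : p = q := polynomial_eq_of_eval_natCast fun n => by rw [← hp, ← hq, h]
  rw [hp, hq, hpq]

theorem mvPolynomial_eval {σ : Type*} {F : σ → ℂ → ℂ} (hF : ∀ i, PolyFun (F i))
    (P : MvPolynomial σ ℂ) : PolyFun fun t => MvPolynomial.eval (fun i => F i t) P := by
  induction P using MvPolynomial.induction_on with
  | C a => simpa using const a
  | add p q hp hq => simpa using hp.add hq
  | mul_X p i hp => simpa using hp.mul (hF i)

end PolyFun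

/-- The polynomial `t ↦ (t choose j)`. -/
def choosePoly (j : ℕ) : Polynomial ℂ := Polynomial.C ((j.factorial : ℂ)⁻¹) * descPochhammer ℂ j

theorem choosePoly_eval_natCast (j n : ℕ) : (choosePoly j).eval (n : ℂ) = (n.choose j : ℂ) := by
  rw [Nat.cast_choose_eq_descPochhammer_div, choosePoly]
  simp [div_eq_inv_mul]

theorem choosePoly_eval_zero (j : ℕ) : (choosePoly j).eval 0 = if j = 0 then 1 else 0 := by
  have := choosePoly_eval_natCast j 0
  rw [Nat.cast_zero] at this
  rw [this]
  rcases j with _ | j <;> simp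

/-- The derivative at `0` of `t ↦ (t choose j)`, i.e. the coefficients of the logarithm. -/
def logCoeff (j : ℕ) : ℂ := (choosePoly j).derivative.eval 0

theorem logCoeff_one : logCoeff 1 = 1 := by simp [logCoeff, choosePoly]

/-- Whichever range is longer, its extra terms vanish: by `ha` on the left, and because `n choose j
= 0` for `j > n` on the right. The number of terms no longer depends on `n`, so the sum becomes
polynomial in `n`. -/
theorem sum_choose_smul_eq {M : Type*} [AddCommGroup M] [Module ℂ M] (a : ℕ → M) {m : ℕ}
    (ha : ∀ j, m ≤ j → a j = 0) (n : ℕ) : ∑ j ∈ Finset.range (n + 1), (n.choose j : ℂ) • a j =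
      ∑ j ∈ Finset.range m, (choosePoly j).eval (n : ℂ) • a j := by
  simp_rw [choosePoly_eval_natCast]
  rcases le_total m (n + 1) with h | h
  · refine (Finset.sum_subset (Finset.range_subset_range.2 h) fun j _ hj => ?_).symm
    rw [Finset.mem_range, not_lt] at hj
    rw [ha j hj, smul_zero]
  · refine Finset.sum_subset (Finset.range_subset_range.2 h) fun j _ hj => ?_
    rw [Finset.mem_range, not_lt] at hj
    rw [Nat.choose_eq_zero_of_lt (by omega), Nat.cast_zero, zero_smul]

theorem one_add_pow_eq_sum_choose {R : Type*} [Ring R] [Algebra ℂ R] (N : R) (n : ℕ) :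
    (1 + N) ^ n = ∑ j ∈ Finset.range (n + 1), (n.choose j : ℂ) • N ^ j := by
  rw [add_comm, (Commute.one_right N).add_pow]
  refine Finset.sum_congr rfl fun j _ => ?_
  rw [one_pow, mul_one, Nat.cast_smul_eq_nsmul, nsmul_eq_mul, (Nat.cast_commute _ _).eq]

theorem one_add_pow_eq_sum {R : Type*} [Ring R] [Algebra ℂ R] (N : R) {m : ℕ} (hm : N ^ m = 0)
    (n : ℕ) : (1 + N) ^ n = ∑ j ∈ Finset.range m, (choosePoly j).eval (n : ℂ) • N ^ j := by
  rw [one_add_pow_eq_sum_choose, sum_choose_smul_eq _ fun j hj => pow_eq_zero_of_le hj hm]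

/-! ### Complex powers and logarithms of unipotent matrices -/

section Matrix

variable {ι : Type*} [Fintype ι] [DecidableEq ι]

/-- Cayley–Hamilton, as the characteristic polynomial is a power of the variable. An exponent that
depends on the size alone makes unipotency a polynomial condition. -/
theorem matrix_pow_card_eq_zero {N : Matrix ι ι ℂ} (hN : IsNilpotent N) :
    N ^ Fintype.card ι = 0 := by
  have h := (Matrix.isNilpotent_charpoly_sub_pow_of_isNilpotent hN).eq_zero
  have h2 := Matrix.aeval_self_charpoly N
  rw [sub_eq_zero.1 h] at h2
  simpa using h2

/-- The complex power `g ^ t` of a unipotent matrix. -/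
def unipotentPow (g : Matrix ι ι ℂ) (t : ℂ) : Matrix ι ι ℂ :=
  -- Nilpotency alone needs only `card ι` terms. The two extra ones put the index 1, which carries
  -- the derivative of the logarithm at the identity, in the range for every `ι`.
  ∑ j ∈ Finset.range (Fintype.card ι + 2), (choosePoly j).eval t • (g - 1) ^ j

/-- The logarithm of a unipotent matrix. -/
def unipotentLog (g : Matrix ι ι ℂ) : Matrix ι ι ℂ :=
  ∑ j ∈ Finset.range (Fintype.card ι + 2), logCoeff j • (g - 1) ^ j

theorem unipotentPow_natCast {g : Matrix ι ι ℂ} (hg : IsNilpotent (g - 1)) (n : ℕ) :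
    unipotentPow g n = g ^ n := by
  rw [unipotentPow, ← one_add_pow_eq_sum _
    (pow_eq_zero_of_le (Nat.le_add_right _ 2) (matrix_pow_card_eq_zero hg)), add_sub_cancel]

theorem polyFun_unipotentPow (g : Matrix ι ι ℂ) (i j : ι) :
    PolyFun fun t => unipotentPow g t i j := by
  simp only [unipotentPow, Matrix.sum_apply, Matrix.smul_apply, smul_eq_mul]
  exact PolyFun.sum _ fun k => (PolyFun.eval _).mul (PolyFun.const _)

/-- Both sides are polynomial in each exponent and agree on natural numbers; `s` is freed first with
the other exponent natural, then `t`. -/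
theorem unipotentPow_add {g : Matrix ι ι ℂ} (hg : IsNilpotent (g - 1)) (s t : ℂ) :
    unipotentPow g (s + t) = unipotentPow g s * unipotentPow g t := by
  have key : ∀ (m : ℕ) (s : ℂ),
      unipotentPow g (s + m) = unipotentPow g s * unipotentPow g m := by
    intro m s
    ext i j
    simp only [Matrix.mul_apply]
    refine PolyFun.ext ((polyFun_unipotentPow g i j).add_const m)
      (PolyFun.sum _ fun k => (polyFun_unipotentPow g i k).mul (PolyFun.const _)) (fun n => ?_) s
    simp only [← Matrix.mul_apply]
    rw [← Nat.cast_add, unipotentPow_natCast hg, unipotentPow_natCast hg,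
      unipotentPow_natCast hg, pow_add]
  ext i j
  simp only [Matrix.mul_apply]
  refine PolyFun.ext ((polyFun_unipotentPow g i j).const_add s)
    (PolyFun.sum _ fun k => (PolyFun.const _).mul (polyFun_unipotentPow g k j)) (fun m => ?_) t
  simp only [← Matrix.mul_apply]
  exact congrFun (congrFun (key m s) i) j

theorem unipotentPow_zero {g : Matrix ι ι ℂ} (hg : IsNilpotent (g - 1)) :
    unipotentPow g 0 = 1 := by
  simpa using unipotentPow_natCast hg 0

theorem unipotentPow_one {g : Matrix ι ι ℂ} (hg : IsNilpotent (g - 1)) :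
    unipotentPow g 1 = g := by
  simpa using unipotentPow_natCast hg 1

/-- Entrywise, the logarithm is the derivative at `0` of the powers. -/
theorem unipotentLog_apply_of_eval {g : Matrix ι ι ℂ} {i j : ι} {p : Polynomial ℂ}
    (hp : ∀ t, unipotentPow g t i j = p.eval t) : unipotentLog g i j = p.derivative.eval 0 := by
  have : p = ∑ k ∈ Finset.range (Fintype.card ι + 2),
      choosePoly k * Polynomial.C (((g - 1) ^ k) i j) := by
    refine Polynomial.funext fun t => ?_
    rw [← hp, unipotentPow]
    simp [Matrix.sum_apply, Polynomial.eval_finsetSum]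
  rw [this, unipotentLog]
  simp [Matrix.sum_apply, Polynomial.eval_finsetSum, logCoeff, Polynomial.derivative_mul]

theorem unipotentLog_conj (u g : GL ι ℂ) :
    unipotentLog ((u * g * u⁻¹ : GL ι ℂ) : Matrix ι ι ℂ) =
      (u : Matrix ι ι ℂ) * unipotentLog (g : Matrix ι ι ℂ) * ((u⁻¹ : GL ι ℂ) : Matrix ι ι ℂ) := by
  have h : ((u * g * u⁻¹ : GL ι ℂ) : Matrix ι ι ℂ) - 1 = (u : Matrix ι ι ℂ) *
      ((g : Matrix ι ι ℂ) - 1) * ((u⁻¹ : GL ι ℂ) : Matrix ι ι ℂ) := by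
    rw [mul_sub, sub_mul, mul_one, Units.mul_inv]
    simp
  simp only [unipotentLog, h, Units.conj_pow, Finset.mul_sum, Finset.sum_mul, mul_smul_comm,
    smul_mul_assoc]

open scoped Matrix.Norms.Operator

theorem hasDerivAt_unipotentPow_zero (g : Matrix ι ι ℂ) :
    HasDerivAt (unipotentPow g) (unipotentLog g) 0 := by
  unfold unipotentPow unipotentLog
  refine HasDerivAt.fun_sum fun j _ => ?_
  exact ((choosePoly j).hasDerivAt 0).smul_const _

theorem hasDerivAt_unipotentPow {g : Matrix ι ι ℂ} (hg : IsNilpotent (g - 1)) (t : ℂ) :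
    HasDerivAt (unipotentPow g) (unipotentLog g * unipotentPow g t) t := by
  have h0 : HasDerivAt (unipotentPow g) (unipotentLog g) (t - t) := by
    rw [sub_self]
    exact hasDerivAt_unipotentPow_zero g
  have h1 := (h0.comp_sub_const t t).mul_const (unipotentPow g t)
  refine h1.congr_of_eventuallyEq (Filter.Eventually.of_forall fun s => ?_)
  change _ = unipotentPow g (s - t) * unipotentPow g t
  rw [← unipotentPow_add hg, sub_add_cancel]

/-- Uniqueness for `E' = A E`, `E 0 = 1`: the product `exp (-s A) g ^ s` has derivative zero, so it
is constantly 1. -/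
theorem exp_smul_unipotentLog {g : Matrix ι ι ℂ} (hg : IsNilpotent (g - 1)) (t : ℂ) :
    NormedSpace.exp (t • unipotentLog g) = unipotentPow g t := by
  set A := unipotentLog g
  have hd : ∀ s : ℂ, HasDerivAt
      (fun s : ℂ => NormedSpace.exp (s • (-A)) * unipotentPow g s) 0 s := fun s => by
    refine ((hasDerivAt_exp_smul_const (𝕂 := ℂ) (-A) s).mul
      (hasDerivAt_unipotentPow hg s)).congr_deriv ?_
    rw [mul_assoc, neg_mul, mul_neg, neg_add_cancel]
  have hc : NormedSpace.exp (t • (-A)) * unipotentPow g t = 1 := by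
    have := is_const_of_deriv_eq_zero (fun s => (hd s).differentiableAt) (fun s => (hd s).deriv) t 0
    simpa [unipotentPow_zero hg] using this
  have hinv : NormedSpace.exp (t • A) * NormedSpace.exp (t • (-A)) = 1 := by
    rw [← Matrix.exp_add_of_commute]
    · simp
    · simp
  calc NormedSpace.exp (t • A) = NormedSpace.exp (t • A) *
        (NormedSpace.exp (t • (-A)) * unipotentPow g t) := by rw [hc, mul_one]
    _ = unipotentPow g t := by rw [← mul_assoc, hinv, one_mul]

/-- Only existence matters here. The value, a sum over non-commuting factors, is controlled
indirectly in `hasDerivAt_linearMap_unipotentLog`. -/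
theorem exists_hasDerivAt_sub_one_pow {E : ℂ → Matrix ι ι ℂ} {A : Matrix ι ι ℂ} {t : ℂ}
    (hE : HasDerivAt E A t) (j : ℕ) : ∃ M, HasDerivAt (fun s => (E s - 1) ^ j) M t := by
  induction j with
  | zero =>
    simp_rw [pow_zero]
    exact ⟨0, hasDerivAt_const t (1 : Matrix ι ι ℂ)⟩
  | succ j ih =>
    obtain ⟨M, hM⟩ := ih
    simp_rw [pow_succ]
    exact ⟨_, hM.mul (hE.sub_const 1)⟩

/-- For `j ≥ 2` every term of the product rule retains a factor `E t - 1 = 0`. -/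
theorem hasDerivAt_sub_one_pow {E : ℂ → Matrix ι ι ℂ} {A : Matrix ι ι ℂ} {t : ℂ}
    (hE : HasDerivAt E A t) (h1 : E t = 1) (j : ℕ) :
    HasDerivAt (fun s => (E s - 1) ^ j) (if j = 1 then A else 0) t := by
  rcases j with _ | _ | j
  · simp_rw [pow_zero]
    exact hasDerivAt_const t (1 : Matrix ι ι ℂ)
  · simp_rw [zero_add, pow_one]
    exact hE.sub_const 1
  · obtain ⟨M, hM⟩ := exists_hasDerivAt_sub_one_pow hE (j + 1)
    simp_rw [pow_succ _ (j + 1)]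
    refine (hM.mul (hE.sub_const 1)).congr_deriv ?_
    simp [h1]

/-- The derivative of the logarithm at the identity is the identity. -/
theorem hasDerivAt_unipotentLog {E : ℂ → Matrix ι ι ℂ} {A : Matrix ι ι ℂ} {t : ℂ}
    (hE : HasDerivAt E A t) (h1 : E t = 1) : HasDerivAt (fun s => unipotentLog (E s)) A t := by
  unfold unipotentLog
  have := HasDerivAt.fun_sum (u := Finset.range (Fintype.card ι + 2)) fun j _ =>
    (hasDerivAt_sub_one_pow hE h1 j).const_smul (logCoeff j)
  refine this.congr_deriv ?_
  rw [Finset.sum_eq_single 1]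
  · simp [logCoeff_one]
  · intro j _ hj
    simp [hj]
  · simp

omit [DecidableEq ι] in
theorem hasDerivAt_linearMap (Λ : Matrix ι ι ℂ →ₗ[ℂ] ℂ) {E : ℂ → Matrix ι ι ℂ}
    {A : Matrix ι ι ℂ} {t : ℂ} (hE : HasDerivAt E A t) :
    HasDerivAt (fun s => Λ (E s)) (Λ A) t :=
  (LinearMap.toContinuousLinearMap Λ).hasFDerivAt.comp_hasDerivAt t hE

/-- A linear functional that vanishes on the logarithms of the unipotent elements `exp (t A)`
vanishes on `A`. -/
theorem linearMap_eq_zero_of_unipotentLog_exp (Λ : Matrix ι ι ℂ →ₗ[ℂ] ℂ) (A : Matrix ι ι ℂ)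
    (h : ∀ t : ℂ, Λ (unipotentLog (NormedSpace.exp (t • A))) = 0) : Λ A = 0 := by
  have h1 : HasDerivAt (fun t : ℂ => NormedSpace.exp (t • A)) A 0 := by
    refine (hasDerivAt_exp_smul_const (𝕂 := ℂ) A 0).congr_deriv ?_
    simp
  have h2 := hasDerivAt_linearMap Λ (hasDerivAt_unipotentLog h1 (by simp))
  simp_rw [h] at h2
  exact h2.unique (hasDerivAt_const _ _)

/-! ### Additivity of invariant functionals on logarithms -/

theorem hasDerivAt_exp_smul_mul (Z b : Matrix ι ι ℂ) :
    HasDerivAt (fun s : ℂ => NormedSpace.exp (s • Z) * b) (Z * b) 0 := by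
  refine ((hasDerivAt_exp_smul_const (𝕂 := ℂ) Z 0).mul_const b).congr_deriv ?_
  simp

/-- The derivative at `s = 0` of `(exp (s Z) b) ^ n b ^ (-n)` is `∑ b ^ i Z b ^ (-i)`. -/
theorem hasDerivAt_exp_smul_mul_pow (Z : Matrix ι ι ℂ) (b : GL ι ℂ) (n : ℕ) :
    HasDerivAt (fun s : ℂ => (NormedSpace.exp (s • Z) * (b : Matrix ι ι ℂ)) ^ n)
      ((∑ i ∈ Finset.range n, ((b ^ i : GL ι ℂ) : Matrix ι ι ℂ) * Z *
        (((b ^ i)⁻¹ : GL ι ℂ) : Matrix ι ι ℂ)) * ((b ^ n : GL ι ℂ) : Matrix ι ι ℂ)) 0 := by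
  induction n with
  | zero =>
    simp_rw [pow_zero]
    refine (hasDerivAt_const (0 : ℂ) (1 : Matrix ι ι ℂ)).congr_deriv ?_
    simp
  | succ n ih =>
    simp_rw [pow_succ _ n]
    refine (ih.mul (hasDerivAt_exp_smul_mul Z b)).congr_deriv ?_
    rw [Finset.sum_range_succ, add_mul, Units.val_mul]
    simp only [zero_smul, NormedSpace.exp_zero, one_mul, mul_assoc]
    congr 1
    rw [Units.inv_mul_cancel_left, Units.val_pow_eq_pow_val]

/-- Put `g s = exp (s Z) b`. Expand `g s ^ n` binomially in `g s - 1`, differentiate at `s = 0`,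
multiply by `b ^ (-n)` and apply `Λ`. By invariance the result is `n Λ Z`, and by the expansion it
is a polynomial in `n` whose linear coefficient is the derivative of `Λ (log (g s))`. `Z` and `b`
need not commute. -/
theorem hasDerivAt_linearMap_unipotentLog (Λ : Matrix ι ι ℂ →ₗ[ℂ] ℂ) (Z : Matrix ι ι ℂ)
    (b : GL ι ℂ)
    (hb : ∀ s : ℂ, IsNilpotent (NormedSpace.exp (s • Z) * (b : Matrix ι ι ℂ) - 1))
    (hΛ : ∀ i : ℕ, Λ (((b ^ i : GL ι ℂ) : Matrix ι ι ℂ) * Z *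
        (((b ^ i)⁻¹ : GL ι ℂ) : Matrix ι ι ℂ)) = Λ Z) :
    HasDerivAt (fun s : ℂ => Λ (unipotentLog (NormedSpace.exp (s • Z) * (b : Matrix ι ι ℂ))))
      (Λ Z) 0 := by
  set m := Fintype.card ι + 2 with hm
  set b' : Matrix ι ι ℂ := ((b⁻¹ : GL ι ℂ) : Matrix ι ι ℂ) with hb'
  have hbu : IsNilpotent (b' - 1) := by
    have h := hb 0
    rw [zero_smul, NormedSpace.exp_zero, one_mul] at h
    have h2 : b' - 1 = -b' * ((b : Matrix ι ι ℂ) - 1) := by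
      rw [mul_sub, neg_mul, hb', Units.inv_mul]
      simp [sub_eq_add_neg, add_comm]
    rw [h2]
    refine Commute.isNilpotent_mul_left ?_ h
    refine Commute.sub_right ?_ (Commute.one_right _)
    refine Commute.neg_left ?_
    rw [hb']
    exact (Commute.refl (b : Matrix ι ι ℂ)).units_inv_left
  choose M hM using fun j => exists_hasDerivAt_sub_one_pow (hasDerivAt_exp_smul_mul Z b) j
  have hM0 : M 0 = 0 := by
    have h := hM 0
    simp_rw [pow_zero] at h
    exact h.unique (hasDerivAt_const _ _)
  have hlog : HasDerivAt (fun s : ℂ =>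
      Λ (unipotentLog (NormedSpace.exp (s • Z) * (b : Matrix ι ι ℂ))))
      (∑ j ∈ Finset.range m, logCoeff j * Λ (M j)) 0 := by
    unfold unipotentLog
    have := hasDerivAt_linearMap Λ (HasDerivAt.fun_sum (u := Finset.range m) fun j _ =>
      (hM j).const_smul (logCoeff j))
    refine this.congr_deriv ?_
    simp
  refine hlog.congr_deriv ?_
  -- `q` interpolates `n ↦ Λ ((d/ds) (g s ^ n) * b ^ (-n))` at `s = 0`; the second index comes from
  -- expanding `b ^ (-n)` in powers of `b' - 1`.
  set q : Polynomial ℂ := ∑ j ∈ Finset.range m, ∑ i ∈ Finset.range m,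
    Polynomial.C (Λ (M j * (b' - 1) ^ i)) * (choosePoly j * choosePoly i) with hq
  have hqn : q = Polynomial.C (Λ Z) * Polynomial.X := by
    refine polynomial_eq_of_eval_natCast fun n => ?_
    have h1 : HasDerivAt (fun s : ℂ => (NormedSpace.exp (s • Z) * (b : Matrix ι ι ℂ)) ^ n)
        (∑ j ∈ Finset.range m, (choosePoly j).eval (n : ℂ) • M j) 0 := by
      refine (HasDerivAt.fun_sum (u := Finset.range m) fun j _ =>
        (hM j).const_smul ((choosePoly j).eval (n : ℂ))).congr_of_eventuallyEq
          (Filter.Eventually.of_forall fun s => ?_)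
      exact (unipotentPow_natCast (hb s) n).symm
    have h2 := h1.unique (hasDerivAt_exp_smul_mul_pow Z b n)
    have h3 : b' ^ n = ∑ i ∈ Finset.range m, (choosePoly i).eval (n : ℂ) • (b' - 1) ^ i :=
      (unipotentPow_natCast hbu n).symm
    have h4 : q.eval (n : ℂ) = Λ ((∑ j ∈ Finset.range m, (choosePoly j).eval (n : ℂ) • M j) *
        b' ^ n) := by
      rw [h3, hq]
      simp only [Finset.sum_mul, Finset.mul_sum, map_sum, Polynomial.eval_finsetSum,
        Polynomial.eval_mul, Polynomial.eval_C, smul_mul_assoc, mul_smul_comm, map_smul,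
        smul_eq_mul]
      rw [Finset.sum_comm]
      refine Finset.sum_congr rfl fun j _ => Finset.sum_congr rfl fun i _ => ?_
      ring
    have h5 : ((b ^ n : GL ι ℂ) : Matrix ι ι ℂ) * b' ^ n = 1 := by
      rw [hb', ← Units.val_pow_eq_pow_val, ← Units.val_mul, inv_pow, mul_inv_cancel, Units.val_one]
    rw [h4, h2, mul_assoc, h5, mul_one, map_sum, Finset.sum_congr rfl fun i _ => hΛ i]
    simp only [Finset.sum_const, Finset.card_range, nsmul_eq_mul, Polynomial.eval_mul,
      Polynomial.eval_C, Polynomial.eval_X]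
    ring
  rw [hq] at hqn
  have hder : ∑ j ∈ Finset.range m, ∑ i ∈ Finset.range m, Λ (M j * (b' - 1) ^ i) *
      (logCoeff j * (choosePoly i).eval 0 + (choosePoly j).eval 0 * logCoeff i) = Λ Z := by
    have := congrArg (fun p => (Polynomial.derivative p).eval 0) hqn
    simpa [logCoeff, Polynomial.eval_finsetSum, Polynomial.derivative_mul] using this
  rw [← hder]
  refine Finset.sum_congr rfl fun j _ => ?_
  -- The polynomial `t choose i` vanishes at 0 unless `i = 0`. The terms with `logCoeff i` survive
  -- only for `j = 0`, where `M 0 = 0`.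
  rw [Finset.sum_eq_single 0]
  · rcases j with _ | j
    · simp [hM0]
    · simp [choosePoly_eval_zero, mul_comm]
  · intro i _ hi
    rcases j with _ | j
    · simp [hM0]
    · simp [choosePoly_eval_zero, hi]
  · simp [hm]

/-- An invariant functional is additive on logarithms: `Λ (log (e^Z b)) = Λ Z + Λ (log b)`. -/
theorem linearMap_unipotentLog_exp_mul (Λ : Matrix ι ι ℂ →ₗ[ℂ] ℂ) (Z : Matrix ι ι ℂ)
    (e : ℂ → GL ι ℂ) (he : ∀ t, (e t : Matrix ι ι ℂ) = NormedSpace.exp (t • Z)) (b : GL ι ℂ)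
    (hb : ∀ s : ℂ, IsNilpotent (((e s * b : GL ι ℂ) : Matrix ι ι ℂ) - 1))
    (hΛ : ∀ (i : ℕ) (t : ℂ), Λ ((((e t * b) ^ i : GL ι ℂ) : Matrix ι ι ℂ) * Z *
        ((((e t * b) ^ i)⁻¹ : GL ι ℂ) : Matrix ι ι ℂ)) = Λ Z) :
    Λ (unipotentLog ((e 1 * b : GL ι ℂ) : Matrix ι ι ℂ)) =
      Λ Z + Λ (unipotentLog (b : Matrix ι ι ℂ)) := by
  have hadd : ∀ s t : ℂ, NormedSpace.exp (s • Z) * ((e t * b : GL ι ℂ) : Matrix ι ι ℂ) =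
      ((e (s + t) * b : GL ι ℂ) : Matrix ι ι ℂ) := fun s t => by
    rw [Units.val_mul, Units.val_mul, he, he, ← mul_assoc, add_smul, Matrix.exp_add_of_commute]
    exact ((Commute.refl Z).smul_left s).smul_right t
  set F : ℂ → ℂ := fun t => Λ (unipotentLog ((e t * b : GL ι ℂ) : Matrix ι ι ℂ)) with hF
  -- The derivative at `t` is the derivative at 0 with `b` replaced by `e t * b`, so `F` is affine.
  have hder : ∀ t, HasDerivAt F (Λ Z) t := fun t => by
    have h := hasDerivAt_linearMap_unipotentLog Λ Z (e t * b)
      (fun s => by rw [hadd]; exact hb _) (fun i => hΛ i t)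
    rw [← sub_self t] at h
    refine (h.comp_sub_const t t).congr_of_eventuallyEq (Filter.Eventually.of_forall fun s => ?_)
    simp only [hF]
    rw [hadd, sub_add_cancel]
  have hd2 : ∀ t, HasDerivAt (fun t => F t - t * Λ Z) 0 t := fun t => by
    refine ((hder t).sub ((hasDerivAt_id t).mul_const (Λ Z))).congr_deriv ?_
    simp
  have h0 : e 0 = 1 := by
    ext1
    rw [he, zero_smul, NormedSpace.exp_zero, Units.val_one]
  have := is_const_of_deriv_eq_zero (fun t => (hd2 t).differentiableAt) (fun t => (hd2 t).deriv) 1 0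
  simp only [hF, h0, one_mul, zero_mul, sub_zero] at this
  rw [← this]
  ring

/-! ### Zariski closure of unipotent groups -/

/-- The value of a polynomial in the matrix entries. -/
def entryEval (P : MvPolynomial (ι × ι) ℂ) (h : Matrix ι ι ℂ) : ℂ :=
  MvPolynomial.eval (fun ij => h ij.1 ij.2) P

/-- The matrix of coordinate functions. -/
def genericMatrix (ι : Type*) : Matrix ι ι (MvPolynomial (ι × ι) ℂ) :=
  Matrix.of fun i j => MvPolynomial.X (i, j)

omit [Fintype ι] [DecidableEq ι] in
theorem genericMatrix_map (h : Matrix ι ι ℂ) :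
    (genericMatrix ι).map (MvPolynomial.eval fun ij => h ij.1 ij.2) = h := by
  ext i j
  simp [genericMatrix]

omit [Fintype ι] [DecidableEq ι] in
theorem entryEval_bind₁ (A : Matrix ι ι (MvPolynomial (ι × ι) ℂ)) (P : MvPolynomial (ι × ι) ℂ)
    (h : Matrix ι ι ℂ) :
    entryEval (MvPolynomial.bind₁ (fun ij => A ij.1 ij.2) P) h =
      entryEval P (A.map (MvPolynomial.eval fun ij => h ij.1 ij.2)) := by
  simp only [entryEval, MvPolynomial.eval, MvPolynomial.eval₂Hom_bind₁]
  rfl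

omit [DecidableEq ι] in
theorem exists_entryEval_mul_left (g : Matrix ι ι ℂ) (P : MvPolynomial (ι × ι) ℂ) :
    ∃ Q, ∀ h, entryEval Q h = entryEval P (g * h) := by
  refine ⟨_, fun h => (entryEval_bind₁ (g.map MvPolynomial.C * genericMatrix ι) P h).trans ?_⟩
  rw [Matrix.map_mul, genericMatrix_map]
  congr
  ext
  simp

omit [DecidableEq ι] in
theorem exists_entryEval_mul_right (g : Matrix ι ι ℂ) (P : MvPolynomial (ι × ι) ℂ) :
    ∃ Q, ∀ h, entryEval Q h = entryEval P (h * g) := by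
  refine ⟨_, fun h => (entryEval_bind₁ (genericMatrix ι * g.map MvPolynomial.C) P h).trans ?_⟩
  rw [Matrix.map_mul, genericMatrix_map]
  congr
  ext
  simp

/-- The entries of `∑ c_j (h - 1) ^ j` are polynomials in the entries of `h`. -/
theorem exists_entryEval_sum_sub_one_pow (s : Finset ℕ) (c : ℕ → ℂ) (i j : ι) :
    ∃ Q, ∀ h : Matrix ι ι ℂ, entryEval Q h = (∑ k ∈ s, c k • (h - 1) ^ k) i j := by
  refine ⟨(∑ k ∈ s, (MvPolynomial.C (c k) : MvPolynomial (ι × ι) ℂ) • (genericMatrix ι - 1) ^ k :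
    Matrix ι ι (MvPolynomial (ι × ι) ℂ)) i j, fun h => ?_⟩
  set f := MvPolynomial.eval (fun ij : ι × ι => h ij.1 ij.2)
  have h1 : f.mapMatrix (genericMatrix ι - 1) = h - 1 := by
    rw [map_sub, map_one, RingHom.mapMatrix_apply, genericMatrix_map]
  change f _ = _
  rw [Matrix.sum_apply, Matrix.sum_apply, map_sum]
  refine Finset.sum_congr rfl fun k _ => ?_
  rw [← h1, ← map_pow]
  simp [f]

theorem polyFun_entryEval_unipotentPow (P : MvPolynomial (ι × ι) ℂ) (g : Matrix ι ι ℂ) :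
    PolyFun fun t => entryEval P (unipotentPow g t) := by
  have h : ∀ ij : ι × ι, PolyFun ((fun (ij : ι × ι) t => unipotentPow g t ij.1 ij.2) ij) :=
    fun ij => polyFun_unipotentPow g ij.1 ij.2
  exact PolyFun.mvPolynomial_eval h P

/-- A polynomial that vanishes on the powers of a unipotent matrix vanishes on the complex
powers. -/
theorem entryEval_unipotentPow_eq_zero {P : MvPolynomial (ι × ι) ℂ} {g : Matrix ι ι ℂ}
    (hg : IsNilpotent (g - 1)) (h : ∀ n : ℕ, entryEval P (g ^ n) = 0) (t : ℂ) :
    entryEval P (unipotentPow g t) = 0 :=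
  (polyFun_entryEval_unipotentPow P g).ext (PolyFun.const 0)
    (fun n => by rw [unipotentPow_natCast hg, h]) t

/-- Algebraic groups contain the complex powers of their unipotent elements. -/
theorem IsAlgebraic.mem_of_eq_unipotentPow {H : Subgroup (GL ι ℂ)} (hH : IsAlgebraic H)
    {g h : GL ι ℂ} (hg : g ∈ H) (hu : IsNilpotent ((g : Matrix ι ι ℂ) - 1)) {t : ℂ}
    (h1 : (h : Matrix ι ι ℂ) = unipotentPow (g : Matrix ι ι ℂ) t) : h ∈ H := by
  obtain ⟨S, hS⟩ := hH
  rw [hS]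
  intro P hP
  change entryEval P h = 0
  rw [h1]
  refine entryEval_unipotentPow_eq_zero hu (fun n => ?_) t
  rw [← Units.val_pow_eq_pow_val]
  exact (hS _).1 (pow_mem hg n) P hP

/-- The entries of `(h - 1) ^ card ι` are polynomials in those of `h`, and they vanish on `S`. -/
theorem isNilpotent_sub_one_of_entryEval {S : Set (GL ι ℂ)}
    (hS : ∀ s ∈ S, IsNilpotent ((s : Matrix ι ι ℂ) - 1)) {h : Matrix ι ι ℂ}
    (hh : ∀ P, (∀ s ∈ S, entryEval P s = 0) → entryEval P h = 0) : IsNilpotent (h - 1) := by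
  refine ⟨Fintype.card ι, ?_⟩
  ext i j
  obtain ⟨Q, hQ⟩ := exists_entryEval_sum_sub_one_pow {Fintype.card ι} (fun _ => 1) i j
  have := hh Q fun s hs => by
    rw [hQ]
    simp [matrix_pow_card_eq_zero (hS s hs)]
  rw [hQ] at this
  simpa using this

/-- The common zeros of all polynomials that vanish on `S`. -/
def zariskiSet (S : Set (GL ι ℂ)) : Set (GL ι ℂ) :=
  {h | ∀ P, (∀ s ∈ S, entryEval P (s : Matrix ι ι ℂ) = 0) → entryEval P (h : Matrix ι ι ℂ) = 0}

/-- Right translation by `h` reduces the claim to `g ∈ S`, and left translation by that element then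
reduces it to `h ∈ S`. -/
theorem mul_mem_zariskiSet {S : Subgroup (GL ι ℂ)} {g h : GL ι ℂ}
    (hg : g ∈ zariskiSet (S : Set (GL ι ℂ)))
    (hh : h ∈ zariskiSet (S : Set (GL ι ℂ))) : g * h ∈ zariskiSet (S : Set (GL ι ℂ)) := by
  intro P hP
  obtain ⟨Q, hQ⟩ := exists_entryEval_mul_right (h : Matrix ι ι ℂ) P
  rw [Units.val_mul, ← hQ]
  refine hg Q fun s hs => ?_
  rw [hQ]
  obtain ⟨R, hR⟩ := exists_entryEval_mul_left (s : Matrix ι ι ℂ) P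
  rw [← hR]
  refine hh R fun s' hs' => ?_
  rw [hR, ← Units.val_mul]
  exact hP _ (S.mul_mem hs hs')

theorem one_mem_zariskiSet (S : Subgroup (GL ι ℂ)) : 1 ∈ zariskiSet (S : Set (GL ι ℂ)) :=
  fun _ hP => hP 1 (one_mem S)

/-- The inverse is the value at `t = -1` of the polynomial curve `h ^ t`, whose values at natural
`t` lie in the closure. Unipotency thus avoids dividing by the determinant. -/
theorem inv_mem_zariskiSet {S : Subgroup (GL ι ℂ)}
    (hS : ∀ s ∈ S, IsNilpotent ((s : Matrix ι ι ℂ) - 1)) {h : GL ι ℂ}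
    (hh : h ∈ zariskiSet (S : Set (GL ι ℂ))) : h⁻¹ ∈ zariskiSet (S : Set (GL ι ℂ)) := by
  have hu : IsNilpotent ((h : Matrix ι ι ℂ) - 1) := isNilpotent_sub_one_of_entryEval hS hh
  have hinv : ((h⁻¹ : GL ι ℂ) : Matrix ι ι ℂ) = unipotentPow (h : Matrix ι ι ℂ) (-1) := by
    refine Units.inv_eq_of_mul_eq_one_right ?_
    nth_rewrite 1 [← unipotentPow_one hu]
    rw [← unipotentPow_add hu, add_neg_cancel, unipotentPow_zero hu]
  have hpow : ∀ n : ℕ, h ^ n ∈ zariskiSet (S : Set (GL ι ℂ)) := by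
    intro n
    induction n with
    | zero => simpa using one_mem_zariskiSet S
    | succ n ih =>
      rw [pow_succ]
      exact mul_mem_zariskiSet ih hh
  intro P hP
  rw [hinv]
  refine entryEval_unipotentPow_eq_zero hu (fun n => ?_) (-1)
  rw [← Units.val_pow_eq_pow_val]
  exact hpow n P hP

/-- The Zariski closure of a unipotent subgroup. -/
def zariskiClosure (S : Subgroup (GL ι ℂ)) (hS : ∀ s ∈ S, IsNilpotent ((s : Matrix ι ι ℂ) - 1)) :
    Subgroup (GL ι ℂ) where
  carrier := zariskiSet (S : Set (GL ι ℂ))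
  mul_mem' := mul_mem_zariskiSet
  one_mem' := one_mem_zariskiSet S
  inv_mem' := inv_mem_zariskiSet hS

theorem isAlgebraic_zariskiClosure (S : Subgroup (GL ι ℂ))
    (hS : ∀ s ∈ S, IsNilpotent ((s : Matrix ι ι ℂ) - 1)) : IsAlgebraic (zariskiClosure S hS) :=
  ⟨{P | ∀ s ∈ S, entryEval P (s : Matrix ι ι ℂ) = 0}, fun _ => Iff.rfl⟩

theorem le_zariskiClosure (S : Subgroup (GL ι ℂ))
    (hS : ∀ s ∈ S, IsNilpotent ((s : Matrix ι ι ℂ) - 1)) : S ≤ zariskiClosure S hS :=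
  fun s hs _ hP => hP s hs

theorem isNilpotent_of_mem_zariskiClosure {S : Subgroup (GL ι ℂ)}
    {hS : ∀ s ∈ S, IsNilpotent ((s : Matrix ι ι ℂ) - 1)} {h : GL ι ℂ}
    (hh : h ∈ zariskiClosure S hS) : IsNilpotent ((h : Matrix ι ι ℂ) - 1) :=
  isNilpotent_sub_one_of_entryEval hS hh

/-- A linear functional that vanishes on the logarithms of the elements of a unipotent group
vanishes on those of its Zariski closure. -/
theorem linearMap_unipotentLog_eq_zero_of_mem_zariskiClosure {S : Subgroup (GL ι ℂ)}
    {hS : ∀ s ∈ S, IsNilpotent ((s : Matrix ι ι ℂ) - 1)} (Λ : Matrix ι ι ℂ →ₗ[ℂ] ℂ)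
    (hΛ : ∀ s ∈ S, Λ (unipotentLog (s : Matrix ι ι ℂ)) = 0) {h : GL ι ℂ}
    (hh : h ∈ zariskiClosure S hS) : Λ (unipotentLog (h : Matrix ι ι ℂ)) = 0 := by
  choose Q hQ using fun i j : ι =>
    exists_entryEval_sum_sub_one_pow (Finset.range (Fintype.card ι + 2)) logCoeff i j
  -- The logarithm is a truncated series, so `Λ ∘ log` is itself a polynomial in the entries.
  have key : ∀ g : Matrix ι ι ℂ, entryEval (∑ i, ∑ j,
      MvPolynomial.C (Λ (Matrix.single i j 1)) * Q i j) g = Λ (unipotentLog g) := by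
    intro g
    have h1 : ∀ (i j : ι) (c : ℂ), Λ (Matrix.single i j c) = Λ (Matrix.single i j 1) * c := by
      intro i j c
      rw [mul_comm, ← smul_eq_mul, ← map_smul, Matrix.smul_single, smul_eq_mul, mul_one]
    have h2 : Λ (unipotentLog g) =
        ∑ i, ∑ j, Λ (Matrix.single i j 1) * unipotentLog g i j := by
      conv_lhs => rw [Matrix.matrix_eq_sum_single (unipotentLog g)]
      rw [map_sum]
      refine Finset.sum_congr rfl fun i _ => ?_
      rw [map_sum]
      exact Finset.sum_congr rfl fun j _ => h1 i j _
    rw [h2, entryEval, map_sum]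
    refine Finset.sum_congr rfl fun i _ => ?_
    rw [map_sum]
    refine Finset.sum_congr rfl fun j _ => ?_
    rw [map_mul, MvPolynomial.eval_C]
    exact congrArg _ (hQ i j g)
  rw [← key]
  refine hh _ fun s hs => ?_
  rw [key, hΛ s hs]

end Matrix

/-! ### The filtration by the powers of the maximal ideal -/

/-- The power series of order at least `j`. -/
def orderFilt (n j : ℕ) : Submodule ℂ (PS n) where
  carrier := {f | ∀ d : Fin n →₀ ℕ, d.degree < j → coeff d f = 0}
  add_mem' hf hg d hd := by rw [map_add, hf d hd, hg d hd, add_zero]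
  zero_mem' _ _ := map_zero _
  smul_mem' c f hf d hd := by rw [map_smul, hf d hd, smul_zero]

variable {n : ℕ}

theorem mem_orderFilt_zero (f : PS n) : f ∈ orderFilt n 0 :=
  fun _ hd => absurd hd (Nat.not_lt_zero _)

theorem orderFilt_anti {i j : ℕ} (h : i ≤ j) : orderFilt n j ≤ orderFilt n i :=
  fun _ hf d hd => hf d (hd.trans_le h)

theorem mem_orderFilt_iff_le_order {j : ℕ} {f : PS n} : f ∈ orderFilt n j ↔ (j : ℕ∞) ≤ f.order :=
  ⟨fun h => nat_le_order h, fun h d hd =>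
    coeff_of_lt_order (lt_of_lt_of_le (by exact_mod_cast hd) h)⟩

theorem mul_mem_orderFilt {i j : ℕ} {f g : PS n} (hf : f ∈ orderFilt n i)
    (hg : g ∈ orderFilt n j) : f * g ∈ orderFilt n (i + j) := by
  rw [mem_orderFilt_iff_le_order] at *
  push_cast
  exact (add_le_add hf hg).trans le_order_mul

theorem mem_orderFilt_one {f : PS n} : f ∈ orderFilt n 1 ↔ constantCoeff f = 0 := by
  rw [mem_orderFilt_iff_le_order, Nat.cast_one, one_le_order_iff_constCoeff_eq_zero]

theorem X_mem_orderFilt_one (i : Fin n) : (X i : PS n) ∈ orderFilt n 1 :=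
  mem_orderFilt_one.2 (constantCoeff_X i)

theorem monomial_mem_orderFilt_one {d : Fin n →₀ ℕ} (hd : d ≠ 0) (c : ℂ) :
    (monomial d c : PS n) ∈ orderFilt n 1 := by
  classical
  rw [mem_orderFilt_one, ← coeff_zero_eq_constantCoeff_apply, coeff_monomial, if_neg hd.symm]

theorem ext_of_mem_orderFilt {f g : PS n} (h : ∀ k, f - g ∈ orderFilt n k) : f = g := by
  ext d
  rw [← sub_eq_zero, ← map_sub]
  exact h (d.degree + 1) d (Nat.lt_succ_self _)

/-- The exponents of degree at most `k`. -/
def degreeLE (n k : ℕ) : Finset (Fin n →₀ ℕ) :=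
  (Finsupp.finite_of_degree_le (σ := Fin n) k).toFinset

theorem mem_degreeLE {k : ℕ} {d : Fin n →₀ ℕ} : d ∈ degreeLE n k ↔ d.degree ≤ k := by
  simp [degreeLE]

/-- The coefficients of degree at most `k` of `T f` depend on those of `f`. -/
theorem coeff_linearMap_apply {k : ℕ} (T : PS n →ₗ[ℂ] PS n)
    (hT : ∀ f ∈ orderFilt n (k + 1), T f ∈ orderFilt n (k + 1)) (f : PS n)
    {e : Fin n →₀ ℕ} (he : e.degree ≤ k) :
    coeff e (T f) = ∑ d ∈ degreeLE n k, coeff d f * coeff e (T (monomial d 1)) := by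
  classical
  set p : PS n := ∑ d ∈ degreeLE n k, coeff d f • monomial d (1 : ℂ) with hp
  have h : coeff e (T (f - p)) = 0 := by
    refine hT _ (fun d hd => ?_) e (by omega)
    rw [map_sub, sub_eq_zero, hp, map_sum, Finset.sum_eq_single d]
    · simp
    · intro c _ hc
      rw [map_smul, coeff_monomial, if_neg hc.symm, smul_zero]
    · intro hd'
      exact absurd (mem_degreeLE.2 (Nat.lt_succ_iff.1 hd)) hd'
  rw [map_sub, map_sub, sub_eq_zero] at h
  rw [h, hp, map_sum, map_sum]
  simp

theorem coeff_linearMap_apply_of_mem {k : ℕ} (T : PS n →ₗ[ℂ] PS n)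
    (hT : ∀ f ∈ orderFilt n (k + 1), T f ∈ orderFilt n (k + 1)) {f : PS n}
    (hf : f ∈ orderFilt n 1) {e : Fin n →₀ ℕ} (he : e.degree ≤ k) :
    coeff e (T f) = ∑ d : JetIndex n k, coeff d.1 f * coeff e (T (monomial d.1 1)) := by
  classical
  rw [coeff_linearMap_apply T hT f he]
  symm
  refine Finset.sum_bij_ne_zero (fun d _ _ => d.1) (fun d _ _ => mem_degreeLE.2 d.2.2)
    (fun _ _ _ _ _ _ h => Subtype.ext h) (fun d hd hne => ?_) (fun _ _ _ => rfl)
  refine ⟨⟨d, fun h => hne ?_, mem_degreeLE.1 hd⟩, Finset.mem_univ _, hne, rfl⟩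
  rw [h, hf 0 (by simp), zero_mul]

theorem jetMatrix_mul {k : ℕ} (T S : PS n →ₗ[ℂ] PS n)
    (hT : ∀ f ∈ orderFilt n (k + 1), T f ∈ orderFilt n (k + 1))
    (hS : ∀ f ∈ orderFilt n 1, S f ∈ orderFilt n 1) :
    jetMatrix k (T ∘ₗ S) = jetMatrix k T * jetMatrix k S := by
  ext e d
  rw [Matrix.mul_apply]
  simp only [jetMatrix, Matrix.of_apply, LinearMap.comp_apply]
  rw [coeff_linearMap_apply_of_mem T hT (hS _ (monomial_mem_orderFilt_one d.2.1 1)) e.2.2]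
  exact Finset.sum_congr rfl fun c _ => mul_comm _ _

theorem jetMatrix_one (k : ℕ) : jetMatrix k (1 : Module.End ℂ (PS n)) = 1 := by
  classical
  ext e d
  simp [jetMatrix, coeff_monomial, Matrix.one_apply, Subtype.ext_iff]

theorem jetMatrix_pow {k : ℕ} (T : Module.End ℂ (PS n))
    (hT : ∀ j, ∀ f ∈ orderFilt n j, T f ∈ orderFilt n j) (m : ℕ) :
    jetMatrix k (T ^ m) = jetMatrix k T ^ m := by
  induction m with
  | zero => rw [pow_zero, pow_zero, jetMatrix_one]
  | succ m ih =>
    rw [pow_succ', pow_succ', ← ih]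
    refine jetMatrix_mul T (T ^ m) (hT _) fun f hf => ?_
    clear ih
    induction m with
    | zero => exact hf
    | succ m ih =>
      rw [pow_succ']
      exact hT 1 _ ih

theorem mem_orderFilt_succ_of_jetMatrix_eq_zero {k : ℕ} (T : PS n →ₗ[ℂ] PS n)
    (hT : ∀ j, ∀ f ∈ orderFilt n j, T f ∈ orderFilt n j) (h : jetMatrix k T = 0) {f : PS n}
    (hf : f ∈ orderFilt n 1) : T f ∈ orderFilt n (k + 1) := by
  intro e he
  by_cases h0 : e = 0
  · subst h0
    exact hT 1 f hf 0 (by simp)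
  rw [coeff_linearMap_apply_of_mem T (hT _) hf (Nat.lt_succ_iff.1 he)]
  refine Finset.sum_eq_zero fun d _ => ?_
  have := congrFun (congrFun h ⟨e, h0, Nat.lt_succ_iff.1 he⟩) d
  simp only [jetMatrix, Matrix.of_apply, Matrix.zero_apply] at this
  rw [this, mul_zero]

theorem jetMatrix_eq_zero_of_mem {k : ℕ} (T : PS n →ₗ[ℂ] PS n)
    (h : ∀ f, T f ∈ orderFilt n (k + 1)) : jetMatrix k T = 0 := by
  ext e d
  exact h _ _ (Nat.lt_succ_of_le e.2.2)

/-! ### Algebra endomorphisms and derivations preserve the filtration -/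

/-- If `c` is the constant term of `Φ f`, then `Φ (f - c)` is not a unit; were the constant term of
`f` different from `c`, `f - c` would be one. No continuity of `Φ` is assumed. -/
theorem constantCoeff_algHom (Φ : PS n →ₐ[ℂ] PS n) (f : PS n) :
    constantCoeff (Φ f) = constantCoeff f := by
  set c := constantCoeff (Φ f) with hc
  by_contra h
  have hu : IsUnit (f - algebraMap ℂ (PS n) c) := by
    rw [MvPowerSeries.isUnit_iff_constantCoeff, isUnit_iff_ne_zero, map_sub,
      MvPowerSeries.algebraMap_apply]
    simpa [sub_eq_zero] using fun h' => h h'.symm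
  have h2 := MvPowerSeries.isUnit_iff_constantCoeff.1 (hu.map Φ)
  rw [map_sub, map_sub, AlgHom.commutes, ← hc, MvPowerSeries.algebraMap_apply] at h2
  simp at h2

theorem algHom_mem_orderFilt (Φ : PS n →ₐ[ℂ] PS n) (j : ℕ) :
    ∀ f ∈ orderFilt n j, Φ f ∈ orderFilt n j := by
  induction j with
  | zero => exact fun _ _ => mem_orderFilt_zero _
  | succ j ih =>
    intro f hf
    obtain ⟨g, hg, rfl⟩ := exists_sum_X_mul f hf
    rw [map_sum]
    refine Submodule.sum_mem _ fun i _ => ?_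
    rw [map_mul, add_comm]
    refine mul_mem_orderFilt ?_ (ih _ (hg i))
    rw [mem_orderFilt_one, constantCoeff_algHom, constantCoeff_X]

theorem derivation_mem_orderFilt {Z : Derivation ℂ (PS n) (PS n)} (hZ : Z ∈ formalVF n) (j : ℕ) :
    ∀ f ∈ orderFilt n j, Z f ∈ orderFilt n j := by
  induction j with
  | zero => exact fun _ _ => mem_orderFilt_zero _
  | succ j ih =>
    intro f hf
    obtain ⟨g, hg, rfl⟩ := exists_sum_X_mul f hf
    rw [map_sum]
    refine Submodule.sum_mem _ fun i _ => ?_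
    rw [Derivation.leibniz, smul_eq_mul, smul_eq_mul, add_comm j 1]
    refine Submodule.add_mem _ (mul_mem_orderFilt (X_mem_orderFilt_one i) (ih _ (hg i))) ?_
    rw [add_comm 1 j]
    exact mul_mem_orderFilt (hg i) (mem_orderFilt_one.2 (hZ _ (constantCoeff_X i)))

/-- A derivation is determined by its components. -/
theorem derivation_eq_zero {Z : Derivation ℂ (PS n) (PS n)}
    (h : ∀ i, Z (X i) = 0) : Z = 0 := by
  -- Continuity of `Z` comes for free: writing `f` minus its constant term as `∑ x_i g_i` gains one
  -- order in each round.
  have key : ∀ j, ∀ f, Z f ∈ orderFilt n j := by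
    intro j
    induction j with
    | zero => exact fun _ => mem_orderFilt_zero _
    | succ j ih =>
      intro f
      have h1 : f - algebraMap ℂ (PS n) (constantCoeff f) ∈ orderFilt n (0 + 1) := by
        rw [zero_add, mem_orderFilt_one, map_sub, MvPowerSeries.algebraMap_apply]
        simp
      obtain ⟨g, -, hg⟩ := exists_sum_X_mul _ h1
      have h2 : Z f = Z (f - algebraMap ℂ (PS n) (constantCoeff f)) := by
        rw [map_sub, Derivation.map_algebraMap, sub_zero]
      rw [h2, hg, map_sum]
      refine Submodule.sum_mem _ fun i _ => ?_
      rw [Derivation.leibniz, smul_eq_mul, smul_eq_mul, h, mul_zero, add_zero, add_comm]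
      exact mul_mem_orderFilt (X_mem_orderFilt_one i) (ih _)
  ext1 f
  exact ext_of_mem_orderFilt fun k => by simpa using key k f

/-! ### Topologically unipotent endomorphisms -/

/-- The operator `f ↦ Φ f - f`. -/
def diffOp (Φ : PS n →ₐ[ℂ] PS n) : Module.End ℂ (PS n) := Φ.toLinearMap - 1

theorem diffOp_apply (Φ : PS n →ₐ[ℂ] PS n) (f : PS n) : diffOp Φ f = Φ f - f := rfl

theorem diffOp_mem_orderFilt (Φ : PS n →ₐ[ℂ] PS n) (j : ℕ) :
    ∀ f ∈ orderFilt n j, diffOp Φ f ∈ orderFilt n j :=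
  fun f hf => Submodule.sub_mem _ (algHom_mem_orderFilt Φ j f hf) hf

theorem diffOp_pow_mem_orderFilt (Φ : PS n →ₐ[ℂ] PS n) (j m : ℕ) :
    ∀ f ∈ orderFilt n j, (diffOp Φ ^ m) f ∈ orderFilt n j := by
  induction m with
  | zero => exact fun f hf => hf
  | succ m ih =>
    intro f hf
    rw [pow_succ']
    exact diffOp_mem_orderFilt Φ j _ (ih f hf)

theorem diffOp_mul (Φ : PS n →ₐ[ℂ] PS n) (f g : PS n) : diffOp Φ (f * g) =
    diffOp Φ f * g + f * diffOp Φ g + diffOp Φ f * diffOp Φ g := by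
  simp only [diffOp_apply, map_mul]
  ring

/-- With `Δ = Φ - 1`, `Δ (f g) = Δf g + f Δg + Δf Δg`. Each term spends a step from the budget `p`
of `f` or `q` of `g`, and a factor whose budget is exhausted has gained one order. -/
theorem diffOp_pow_mul_mem (Φ : PS n →ₐ[ℂ] PS n) {i j : ℕ} (m : ℕ) : ∀ (p q : ℕ) (f g : PS n),
    p + q = m → f ∈ orderFilt n i → g ∈ orderFilt n j →
    (diffOp Φ ^ p) f ∈ orderFilt n (i + 1) → (diffOp Φ ^ q) g ∈ orderFilt n (j + 1) →
    (diffOp Φ ^ m) (f * g) ∈ orderFilt n (i + j + 1) := by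
  induction m with
  | zero =>
    intro p q f g hpq hf hg hp hq
    obtain ⟨rfl, rfl⟩ := Nat.add_eq_zero_iff.1 hpq
    exact mul_mem_orderFilt (i := i) (j := j + 1) hf hq
  | succ m ih =>
    intro p q f g hpq hf hg hp hq
    rcases p with _ | p
    · refine diffOp_pow_mem_orderFilt Φ _ _ _ ?_
      rw [add_right_comm]
      exact mul_mem_orderFilt hp hg
    rcases q with _ | q
    · exact diffOp_pow_mem_orderFilt Φ _ _ _ (mul_mem_orderFilt (i := i) (j := j + 1) hf hq)
    rw [pow_succ, Module.End.mul_apply, diffOp_mul, map_add, map_add]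
    rw [pow_succ, Module.End.mul_apply] at hp hq
    have hf' := diffOp_mem_orderFilt Φ _ f hf
    have hg' := diffOp_mem_orderFilt Φ _ g hg
    refine Submodule.add_mem _ (Submodule.add_mem _ ?_ ?_) ?_
    · exact ih p (q + 1) _ _ (by omega) hf' hg hp (by rwa [pow_succ, Module.End.mul_apply])
    · exact ih (p + 1) q _ _ (by omega) hf hg' (by rwa [pow_succ, Module.End.mul_apply]) hq
    · refine ih p (q + 1) _ _ (by omega) hf' hg' hp ?_
      rw [pow_succ', Module.End.mul_apply]
      exact diffOp_mem_orderFilt Φ _ _ hq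

/-- If `Φ - 1` is nilpotent on `𝔪 / 𝔪²`, then it is topologically nilpotent. -/
theorem exists_diffOp_pow_mem (Φ : PS n →ₐ[ℂ] PS n)
    (hΦ : ∃ N, ∀ f ∈ orderFilt n 1, (diffOp Φ ^ N) f ∈ orderFilt n 2) (k : ℕ) :
    ∃ N, ∀ f, (diffOp Φ ^ N) f ∈ orderFilt n k := by
  -- Nilpotency on `𝔪 ^ (j + 1) / 𝔪 ^ (j + 2)` follows from nilpotency on `𝔪 / 𝔪²` and on the
  -- previous quotient, since elements are sums of products `x_i g_i`.
  have step : ∀ j, ∃ N, ∀ f ∈ orderFilt n j, (diffOp Φ ^ N) f ∈ orderFilt n (j + 1) := by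
    intro j
    induction j with
    | zero =>
      refine ⟨1, fun f _ => ?_⟩
      rw [pow_one, zero_add, mem_orderFilt_one, diffOp_apply, map_sub, constantCoeff_algHom,
        sub_self]
    | succ j ih =>
      obtain ⟨N, hN⟩ := ih
      obtain ⟨M, hM⟩ := hΦ
      refine ⟨M + N, fun f hf => ?_⟩
      obtain ⟨g, hg, rfl⟩ := exists_sum_X_mul f hf
      rw [map_sum]
      refine Submodule.sum_mem _ fun i _ => ?_
      rw [add_comm j 1]
      exact diffOp_pow_mul_mem Φ (M + N) M N _ _ rfl (X_mem_orderFilt_one i) (hg i)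
        (hM _ (X_mem_orderFilt_one i)) (hN _ (hg i))
  induction k with
  | zero => exact ⟨0, fun f => mem_orderFilt_zero _⟩
  | succ k ih =>
    obtain ⟨N, hN⟩ := ih
    obtain ⟨M, hM⟩ := step k
    refine ⟨M + N, fun f => ?_⟩
    rw [pow_add, Module.End.mul_apply]
    exact hM _ (hN f)

/-- The coefficients of the iterates `Φ ^ m` are polynomials in `m`. -/
def IsIterPoly (Φ : PS n →ₐ[ℂ] PS n) : Prop :=
  ∀ (e : Fin n →₀ ℕ) (f : PS n), ∃ q : Polynomial ℂ, ∀ m : ℕ, q.eval (m : ℂ) = coeff e ((Φ ^ m) f)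

theorem toLinearMap_pow (Φ : PS n →ₐ[ℂ] PS n) (m : ℕ) :
    (Φ ^ m).toLinearMap = (Φ.toLinearMap : Module.End ℂ (PS n)) ^ m := by
  induction m with
  | zero => rfl
  | succ m ih =>
    rw [pow_succ, pow_succ, ← ih]
    rfl

/-- In the binomial expansion of `(1 + Δ) ^ m` only finitely many powers of `Δ = Φ - 1` reach the
coefficient `e`, each weighted by the polynomial `m choose j`. -/
theorem isIterPoly_of_diffOp (Φ : PS n →ₐ[ℂ] PS n)
    (hΦ : ∃ N, ∀ f ∈ orderFilt n 1, (diffOp Φ ^ N) f ∈ orderFilt n 2) : IsIterPoly Φ := by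
  intro e f
  obtain ⟨N, hN⟩ := exists_diffOp_pow_mem Φ hΦ (e.degree + 1)
  refine ⟨∑ j ∈ Finset.range N, choosePoly j * Polynomial.C (coeff e ((diffOp Φ ^ j) f)),
    fun m => ?_⟩
  have h1 : (Φ ^ m) f = ∑ j ∈ Finset.range (m + 1), (m.choose j : ℂ) • (diffOp Φ ^ j) f := by
    have h2 : (Φ.toLinearMap : Module.End ℂ (PS n)) = 1 + diffOp Φ := by
      rw [diffOp, add_sub_cancel]
    rw [← AlgHom.toLinearMap_apply, toLinearMap_pow, h2, one_add_pow_eq_sum_choose]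
    simp
  have h3 := sum_choose_smul_eq (fun j => coeff e ((diffOp Φ ^ j) f)) (m := N) (fun j hj => by
    obtain ⟨i, rfl⟩ := Nat.exists_eq_add_of_le hj
    rw [pow_add, Module.End.mul_apply]
    exact hN _ e (Nat.lt_succ_self _)) m
  rw [h1, map_sum]
  simp only [map_smul]
  rw [h3]
  simp [Polynomial.eval_finsetSum]

/-- The power series with given coefficients. -/
def ofCoeff (c : (Fin n →₀ ℕ) → ℂ) : PS n := c

theorem coeff_ofCoeff (c : (Fin n →₀ ℕ) → ℂ) (e : Fin n →₀ ℕ) : coeff e (ofCoeff c) = c e := rfl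

/-- The polynomial `m ↦ coeff e (Φ ^ m f)`. -/
def iterPoly {Φ : PS n →ₐ[ℂ] PS n} (h : IsIterPoly Φ) (e : Fin n →₀ ℕ) (f : PS n) : Polynomial ℂ :=
  (h e f).choose

section IterPoly

variable {Φ : PS n →ₐ[ℂ] PS n} (h : IsIterPoly Φ)

theorem iterPoly_eval_natCast (e : Fin n →₀ ℕ) (f : PS n) (m : ℕ) :
    (iterPoly h e f).eval (m : ℂ) = coeff e ((Φ ^ m) f) := (h e f).choose_spec m

theorem iterPoly_eval_zero (e : Fin n →₀ ℕ) (f : PS n) :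
    (iterPoly h e f).eval 0 = coeff e f := by
  simpa using iterPoly_eval_natCast h e f 0

theorem iterPoly_add (e : Fin n →₀ ℕ) (f g : PS n) :
    iterPoly h e (f + g) = iterPoly h e f + iterPoly h e g :=
  polynomial_eq_of_eval_natCast fun m => by
    simp [iterPoly_eval_natCast]

theorem iterPoly_smul (e : Fin n →₀ ℕ) (c : ℂ) (f : PS n) :
    iterPoly h e (c • f) = Polynomial.C c * iterPoly h e f :=
  polynomial_eq_of_eval_natCast fun m => by
    simp [iterPoly_eval_natCast]

theorem iterPoly_mul (e : Fin n →₀ ℕ) (f g : PS n) : iterPoly h e (f * g) =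
    ∑ p ∈ Finset.HasAntidiagonal.antidiagonal e, iterPoly h p.1 f * iterPoly h p.2 g :=
  polynomial_eq_of_eval_natCast fun m => by
    classical
    simp [iterPoly_eval_natCast, Polynomial.eval_finsetSum, coeff_mul]

theorem iterPoly_algebraMap (e : Fin n →₀ ℕ) (c : ℂ) :
    iterPoly h e (algebraMap ℂ (PS n) c) = Polynomial.C (coeff e (algebraMap ℂ (PS n) c)) :=
  polynomial_eq_of_eval_natCast fun m => by
    rw [iterPoly_eval_natCast, AlgHom.commutes, Polynomial.eval_C]

/-- The complex power `Φ ^ t`. -/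
def complexPow (t : ℂ) : PS n →ₐ[ℂ] PS n where
  toFun f := ofCoeff fun e => (iterPoly h e f).eval t
  map_one' := by
    ext e
    rw [coeff_ofCoeff, ← map_one (algebraMap ℂ (PS n)), iterPoly_algebraMap, Polynomial.eval_C]
  map_mul' f g := by
    classical
    ext e
    rw [coeff_mul, coeff_ofCoeff, iterPoly_mul, Polynomial.eval_finsetSum]
    exact Finset.sum_congr rfl fun p _ => Polynomial.eval_mul
  map_zero' := by
    ext e
    rw [coeff_ofCoeff, ← map_zero (algebraMap ℂ (PS n)), iterPoly_algebraMap, Polynomial.eval_C]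
  map_add' f g := by
    ext e
    rw [map_add, coeff_ofCoeff, coeff_ofCoeff, coeff_ofCoeff, iterPoly_add, Polynomial.eval_add]
  commutes' c := by
    ext e
    rw [coeff_ofCoeff, iterPoly_algebraMap, Polynomial.eval_C]

theorem coeff_complexPow (t : ℂ) (e : Fin n →₀ ℕ) (f : PS n) :
    coeff e (complexPow h t f) = (iterPoly h e f).eval t := rfl

theorem polyFun_coeff_complexPow (e : Fin n →₀ ℕ) (f : PS n) :
    PolyFun fun t => coeff e (complexPow h t f) := PolyFun.eval (iterPoly h e f)

theorem complexPow_natCast (m : ℕ) : complexPow h m = Φ ^ m := by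
  ext f e
  rw [coeff_complexPow, iterPoly_eval_natCast]

theorem complexPow_add (s t : ℂ) (f : PS n) :
    complexPow h (s + t) f = complexPow h s (complexPow h t f) := by
  have key : ∀ (m : ℕ) (t : ℂ), complexPow h (m + t) f = (Φ ^ m) (complexPow h t f) := by
    intro m t
    ext e
    -- A coefficient of `(Φ ^ m) g` is a finite linear combination of coefficients of `g`, so the
    -- right side is polynomial in `t`.
    rw [← AlgHom.toLinearMap_apply (Φ ^ m), coeff_linearMap_apply (k := e.degree) _
      (algHom_mem_orderFilt (Φ ^ m) _) _ le_rfl]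
    refine ((polyFun_coeff_complexPow h e f).const_add (m : ℂ)).ext
      (PolyFun.sum _ fun d => (polyFun_coeff_complexPow h d f).mul (PolyFun.const _))
      (fun l => ?_) t
    rw [← coeff_linearMap_apply (k := e.degree) _ (algHom_mem_orderFilt (Φ ^ m) _) _ le_rfl,
      AlgHom.toLinearMap_apply, complexPow_natCast, ← Nat.cast_add, complexPow_natCast, pow_add]
    rfl
  ext e
  refine ((polyFun_coeff_complexPow h e f).add_const t).ext
    (polyFun_coeff_complexPow h e (complexPow h t f)) (fun m => ?_) s
  rw [key, complexPow_natCast]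

theorem complexPow_zero (f : PS n) : complexPow h 0 f = f := by
  rw [← Nat.cast_zero, complexPow_natCast, pow_zero]
  rfl

theorem complexPow_one (f : PS n) : complexPow h 1 f = Φ f := by
  rw [← Nat.cast_one, complexPow_natCast, pow_one]

/-- The formal diffeomorphism `Φ ^ t`. -/
def complexPowEquiv (t : ℂ) : FormalDiff n :=
  AlgEquiv.ofAlgHom (complexPow h t) (complexPow h (-t))
    (AlgHom.ext fun f => by
      rw [AlgHom.comp_apply, ← complexPow_add, add_neg_cancel, complexPow_zero]
      rfl)
    (AlgHom.ext fun f => by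
      rw [AlgHom.comp_apply, ← complexPow_add, neg_add_cancel, complexPow_zero]
      rfl)

/-- The logarithm of `Φ`: the derivative of the one-parameter group `Φ ^ t` at `t = 0`. -/
def logDerivation : Derivation ℂ (PS n) (PS n) :=
  Derivation.mk'
    { toFun := fun f => ofCoeff fun e => (iterPoly h e f).derivative.eval 0
      map_add' := by
        intro f g
        ext e
        rw [map_add, coeff_ofCoeff, coeff_ofCoeff, coeff_ofCoeff, iterPoly_add,
          Polynomial.derivative_add, Polynomial.eval_add]
      map_smul' := by
        intro c f
        ext e
        rw [RingHom.id_apply, map_smul, coeff_ofCoeff, coeff_ofCoeff, iterPoly_smul,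
          Polynomial.derivative_C_mul, Polynomial.eval_mul, Polynomial.eval_C, smul_eq_mul] }
    (by
      classical
      intro f g
      ext e
      simp only [LinearMap.coe_mk, AddHom.coe_mk]
      rw [smul_eq_mul, smul_eq_mul, mul_comm g, map_add, coeff_mul, coeff_mul,
        ← Finset.sum_add_distrib, coeff_ofCoeff, iterPoly_mul, Polynomial.derivative_sum,
        Polynomial.eval_finsetSum]
      refine Finset.sum_congr rfl fun p _ => ?_
      rw [Polynomial.derivative_mul, Polynomial.eval_add, Polynomial.eval_mul, Polynomial.eval_mul,
        iterPoly_eval_zero, iterPoly_eval_zero, add_comm, coeff_ofCoeff, coeff_ofCoeff])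

theorem coeff_logDerivation (e : Fin n →₀ ℕ) (f : PS n) :
    coeff e (logDerivation h f) = (iterPoly h e f).derivative.eval 0 := rfl

theorem logDerivation_mem : logDerivation h ∈ formalVF n := by
  intro f hf
  rw [← coeff_zero_eq_constantCoeff_apply, coeff_logDerivation]
  have : iterPoly h 0 f = 0 := polynomial_eq_of_eval_natCast fun m => by
    rw [iterPoly_eval_natCast, coeff_zero_eq_constantCoeff_apply, constantCoeff_algHom, hf,
      Polynomial.eval_zero]
  rw [this, Polynomial.derivative_zero, Polynomial.eval_zero]

theorem jetMatrix_complexPow {k : ℕ} (hu : IsNilpotent (jetMatrix k Φ.toLinearMap - 1)) (t : ℂ) :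
    jetMatrix k (complexPow h t).toLinearMap = unipotentPow (jetMatrix k Φ.toLinearMap) t := by
  ext e d
  refine (polyFun_coeff_complexPow h e.1 (monomial d.1 1)).ext (polyFun_unipotentPow _ e d)
    (fun m => ?_) t
  rw [unipotentPow_natCast hu, ← jetMatrix_pow _ (algHom_mem_orderFilt Φ), ← toLinearMap_pow,
    complexPow_natCast]
  rfl

theorem jetMatrix_logDerivation {k : ℕ} (hu : IsNilpotent (jetMatrix k Φ.toLinearMap - 1)) :
    jetMatrix k (logDerivation h : PS n →ₗ[ℂ] PS n) = unipotentLog (jetMatrix k Φ.toLinearMap) := by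
  ext e d
  symm
  refine unipotentLog_apply_of_eval fun t => ?_
  rw [← jetMatrix_complexPow h hu, ← coeff_complexPow]
  rfl

end IterPoly

open scoped commutatorElement

/-! ### Connected subgroups -/

section Connected

variable {G : Type*} [Group G] [TopologicalSpace G] [IsTopologicalGroup G]

/-- The subgroup generated by a connected set that contains `1` is connected. -/
theorem isPreconnected_subgroup_closure {T : Set G} (hT : IsPreconnected T) (h1 : (1 : G) ∈ T) :
    IsPreconnected (Subgroup.closure T : Set G) := by
  refine isPreconnected_of_forall 1 fun x hx => ?_
  have key : ∀ x ∈ Subgroup.closure T, ∃ S ⊆ (Subgroup.closure T : Set G),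
      (1 : G) ∈ S ∧ x ∈ S ∧ IsPreconnected S := by
    intro x hx
    induction hx using Subgroup.closure_induction with
    | mem x hx => exact ⟨T, Subgroup.subset_closure, h1, hx, hT⟩
    | one => exact ⟨T, Subgroup.subset_closure, h1, h1, hT⟩
    | mul x y hx hy ihx ihy =>
      obtain ⟨S, hS, h1S, hxS, hSc⟩ := ihx
      obtain ⟨R, hR, h1R, hyR, hRc⟩ := ihy
      refine ⟨S ∪ (fun z => x * z) '' R, ?_, Or.inl h1S, Or.inr ⟨y, hyR, rfl⟩, ?_⟩
      · refine Set.union_subset hS ?_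
        rintro _ ⟨z, hz, rfl⟩
        exact mul_mem hx (hR hz)
      · exact IsPreconnected.union x hxS ⟨1, h1R, mul_one x⟩ hSc
          (hRc.image _ (continuous_const_mul x).continuousOn)
    | inv x hx ihx =>
      obtain ⟨S, hS, h1S, hxS, hSc⟩ := ihx
      refine ⟨(fun z => x⁻¹ * z) '' S, ?_, ⟨x, hxS, inv_mul_cancel x⟩, ⟨1, h1S, mul_one _⟩,
        hSc.image _ (continuous_const_mul x⁻¹).continuousOn⟩
      rintro _ ⟨z, hz, rfl⟩
      exact mul_mem (inv_mem hx) (hS hz)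
  exact key x hx

theorem isPreconnected_commutator {K : Subgroup G} (hK : IsPreconnected (K : Set G)) :
    IsPreconnected ((⁅K, K⁆ : Subgroup G) : Set G) := by
  rw [Subgroup.commutator_def]
  refine isPreconnected_subgroup_closure ?_ ⟨1, one_mem K, 1, one_mem K, by simp⟩
  have : {g : G | ∃ g₁ ∈ K, ∃ g₂ ∈ K, ⁅g₁, g₂⁆ = g} =
      (fun p : G × G => ⁅p.1, p.2⁆) '' ((K : Set G) ×ˢ (K : Set G)) := by
    ext g
    constructor
    · rintro ⟨a, ha, b, hb, rfl⟩
      exact ⟨(a, b), ⟨ha, hb⟩, rfl⟩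
    · rintro ⟨⟨a, b⟩, ⟨ha, hb⟩, rfl⟩
      exact ⟨a, ha, b, hb, rfl⟩
  rw [this]
  refine (hK.prod hK).image _ (Continuous.continuousOn ?_)
  simp only [commutatorElement_def]
  fun_prop

theorem isPreconnected_derivedSeries [PreconnectedSpace G] (i : ℕ) :
    IsPreconnected (derivedSeries G i : Set G) := by
  induction i with
  | zero => simpa using isPreconnected_univ
  | succ i ih => exact isPreconnected_commutator ih

/-- A continuous function on a connected space with finitely many values is constant. -/
theorem eq_of_continuous_of_finite {X : Type*} [TopologicalSpace X] [PreconnectedSpace X]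
    {f : X → ℂ} (hf : Continuous f) {s : Set ℂ} (hs : s.Finite) (h : ∀ x, f x ∈ s) (x y : X) :
    f x = f y := by
  have h1 : IsPreconnected (Set.range f) := isPreconnected_range hf
  have h2 : (Set.range f).Finite := hs.subset (Set.range_subset_iff.2 h)
  have h3 : (Set.range f).Subsingleton := h2.countable.isTotallyDisconnected _ subset_rfl h1
  exact h3 ⟨x, rfl⟩ ⟨y, rfl⟩

end Connected

/-! ### The theorem of Lie and Kolchin -/

section LieKolchin

/-- Continuity of the matrix coefficients of a representation. -/
def IsContinuousRep {K V : Type*} [Group K] [TopologicalSpace K] [AddCommGroup V] [Module ℂ V]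
    (ρ : K →* Module.End ℂ V) : Prop :=
  ∀ (v : V) (f : Module.Dual ℂ V), Continuous fun k => f (ρ k v)

/-- The restriction of a representation to an invariant subspace. -/
def restrictRep {K V : Type*} [Group K] [AddCommGroup V] [Module ℂ V] (ρ : K →* Module.End ℂ V)
    (W : Submodule ℂ V) (hW : ∀ k, ∀ w ∈ W, ρ k w ∈ W) : K →* Module.End ℂ W where
  toFun k := (ρ k).restrict (hW k)
  map_one' := by
    ext w
    simp
  map_mul' k l := by
    ext w
    simp

/-- The representation on the quotient by an invariant subspace. -/
def quotientRep {K V : Type*} [Group K] [AddCommGroup V] [Module ℂ V] (ρ : K →* Module.End ℂ V)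
    (W : Submodule ℂ V) (hW : ∀ k, ∀ w ∈ W, ρ k w ∈ W) : K →* Module.End ℂ (V ⧸ W) where
  toFun k := W.mapQ W (ρ k) (hW k)
  map_one' := by
    ext w
    simp
  map_mul' k l := by
    ext w
    simp

theorem isContinuousRep_restrictRep {K V : Type*} [Group K] [TopologicalSpace K] [AddCommGroup V]
    [Module ℂ V] {ρ : K →* Module.End ℂ V} (hρ : IsContinuousRep ρ)
    (W : Submodule ℂ V) (hW : ∀ k, ∀ w ∈ W, ρ k w ∈ W) :
    IsContinuousRep (restrictRep ρ W hW) := by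
  intro w f
  obtain ⟨g, rfl⟩ := LinearMap.exists_extend f
  exact hρ w g

theorem isContinuousRep_quotientRep {K V : Type*} [Group K] [TopologicalSpace K] [AddCommGroup V]
    [Module ℂ V] {ρ : K →* Module.End ℂ V} (hρ : IsContinuousRep ρ)
    (W : Submodule ℂ V) (hW : ∀ k, ∀ w ∈ W, ρ k w ∈ W) :
    IsContinuousRep (quotientRep ρ W hW) := by
  intro w f
  obtain ⟨v, rfl⟩ := W.mkQ_surjective w
  exact hρ v (f ∘ₗ W.mkQ)

/-- Every continuous representation of `K` has a common eigenvector. -/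
def HasEigenvectors (K : Type*) [Group K] [TopologicalSpace K] : Prop :=
  ∀ (V : Type) [AddCommGroup V] [Module ℂ V] [FiniteDimensional ℂ V] [Nontrivial V]
    (ρ : K →* Module.End ℂ V), IsContinuousRep ρ → ∃ v : V, v ≠ 0 ∧ ∀ k, ∃ c : ℂ, ρ k v = c • v

variable {G : Type*} [Group G] [TopologicalSpace G] [IsTopologicalGroup G]

/-- Induction on `dim V`; a proper nonzero invariant subspace suffices. Take the weight space `W` of
a character `χ` of `⁅K, K⁆`. Conjugation by `K` moves `χ c` continuously among the finitely many
eigenvalues of `c`, so `χ` is fixed and `W` is invariant. If `W = V`, commutators are scalars of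
determinant 1, hence roots of unity, hence 1 by connectedness. The operators then commute, and an
eigenspace of a non-scalar one is proper and invariant. -/
theorem hasEigenvectors_of_commutator {K : Subgroup G} (hK : IsPreconnected (K : Set G))
    (hD : HasEigenvectors (⁅K, K⁆ : Subgroup G)) : HasEigenvectors K := by
  have hle : ⁅K, K⁆ ≤ K := Subgroup.commutator_le.2 fun g hg k hk =>
    mul_mem (mul_mem (mul_mem hg hk) (inv_mem hg)) (inv_mem hk)
  have : PreconnectedSpace K := isPreconnected_iff_preconnectedSpace.1 hK
  intro V _ _ _ _ ρ hρ
  induction hd : Module.finrank ℂ V using Nat.strong_induction_on generalizing V with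
  | _ d ih =>
  have hsub : ∀ W : Submodule ℂ V, W ≠ ⊥ → W ≠ ⊤ → (∀ k, ∀ w ∈ W, ρ k w ∈ W) →
      ∃ v : V, v ≠ 0 ∧ ∀ k, ∃ c : ℂ, ρ k v = c • v := by
    intro W hbot htop hW
    have := Submodule.nontrivial_iff_ne_bot.2 hbot
    obtain ⟨w, hw, h⟩ := ih _ (hd ▸ Submodule.finrank_lt htop) W
      (restrictRep ρ W hW) (isContinuousRep_restrictRep hρ W hW) rfl
    refine ⟨w, by simpa using hw, fun k => ?_⟩
    obtain ⟨c, hc⟩ := h k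
    exact ⟨c, congrArg Subtype.val hc⟩
  have hinj : ∀ k v, ρ k v = 0 → v = 0 := by
    intro k v h
    have : ρ (k⁻¹ * k) v = 0 := by rw [map_mul, Module.End.mul_apply, h, map_zero]
    simpa using this
  obtain ⟨v₀, hv₀, hχ⟩ := hD V (ρ.comp (Subgroup.inclusion hle))
    (fun v f => (hρ v f).comp (continuous_subtype_val.subtype_mk _))
  choose χ hχ using hχ
  let W : Submodule ℂ V :=
    { carrier := {w | ∀ c : (⁅K, K⁆ : Subgroup G), ρ (Subgroup.inclusion hle c) w = χ c • w}
      add_mem' := by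
        intro v w hv hw c
        rw [map_add, hv, hw, smul_add]
      zero_mem' := by
        intro c
        simp
      smul_mem' := by
        intro a w hw c
        rw [map_smul, hw, smul_comm] }
  have hWbot : W ≠ ⊥ := fun h => hv₀ ((Submodule.mem_bot ℂ).1 (h ▸ (hχ : v₀ ∈ W)))
  -- conjugation by `K` does not change the weight
  have hWst : ∀ k, ∀ w ∈ W, ρ k w ∈ W := by
    intro k w hw c
    by_cases hw0 : w = 0
    · simp [hw0]
    obtain ⟨f, hf⟩ := Module.Projective.exists_dual_ne_zero ℂ hw0
    have hcl : ∀ k : K, ((k : G)⁻¹ * c * k : G) ∈ ⁅K, K⁆ := fun k => by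
      have h1 : ((k : G)⁻¹ * c * k : G) = ⁅(k : G)⁻¹, (c : G)⁆ * c := by
        simp [commutatorElement_def, mul_assoc]
      rw [h1]
      exact mul_mem (Subgroup.commutator_mem_commutator (inv_mem k.2) (hle c.2)) c.2
    let c' : K → (⁅K, K⁆ : Subgroup G) := fun k => ⟨_, hcl k⟩
    have hc' : ∀ k, ρ (Subgroup.inclusion hle c) (ρ k w) = χ (c' k) • ρ k w := by
      intro k
      have h1 : Subgroup.inclusion hle c * k = k * Subgroup.inclusion hle (c' k) := by
        ext
        simp [c', mul_assoc]
      rw [← Module.End.mul_apply, ← map_mul, h1, map_mul, Module.End.mul_apply, hw, map_smul]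
    have hcont : Continuous fun k : K => χ (c' k) := by
      have h1 : (fun k : K => χ (c' k)) =
          fun k : K => f (ρ (k⁻¹ * Subgroup.inclusion hle c * k) w) / f w := by
        ext k
        have : (k⁻¹ * Subgroup.inclusion hle c * k : K) = Subgroup.inclusion hle (c' k) := rfl
        rw [this, hw, map_smul, smul_eq_mul, mul_div_cancel_right₀ _ hf]
      rw [h1]
      exact ((hρ w f).comp (by fun_prop)).div_const _
    have hval : ∀ k, χ (c' k) ∈ {μ | (ρ (Subgroup.inclusion hle c)).HasEigenvalue μ} := fun k =>
      Module.End.hasEigenvalue_of_hasEigenvector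
        ⟨Module.End.mem_eigenspace_iff.2 (hc' k), fun h => hw0 (hinj k w h)⟩
    have := eq_of_continuous_of_finite hcont (Module.End.finite_hasEigenvalue _) hval k 1
    rw [hc' k, this]
    congr 2
    ext
    simp [c']
  by_cases hWtop : W = ⊤
  swap
  · exact hsub W hWbot hWtop hWst
  -- the commutators act trivially
  have hcomm : ∀ k l : K, ρ k * ρ l = ρ l * ρ k := by
    intro k l
    let c : K → (⁅K, K⁆ : Subgroup G) := fun k =>
      ⟨⁅(k : G), (l : G)⁆, Subgroup.commutator_mem_commutator k.2 l.2⟩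
    have hc : ∀ k, Subgroup.inclusion hle (c k) = ⁅k, l⁆ := fun k => rfl
    have hact : ∀ k, ρ ⁅k, l⁆ = χ (c k) • 1 := by
      intro k
      ext w
      have : w ∈ W := hWtop ▸ Submodule.mem_top
      rw [← hc, this (c k)]
      rfl
    obtain ⟨f, hf⟩ := Module.Projective.exists_dual_ne_zero ℂ hv₀
    have hcont : Continuous fun k : K => χ (c k) := by
      have h1 : (fun k : K => χ (c k)) = fun k : K => f (ρ ⁅k, l⁆ v₀) / f v₀ := by
        ext k
        rw [hact, LinearMap.smul_apply, Module.End.one_apply, map_smul, smul_eq_mul,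
          mul_div_cancel_right₀ _ hf]
      rw [h1]
      simp only [commutatorElement_def]
      exact ((hρ v₀ f).comp (f := fun k : K => k * l * k⁻¹ * l⁻¹) (by fun_prop)).div_const _
    have hval : ∀ k, χ (c k) ∈ {z : ℂ | z ^ Module.finrank ℂ V = 1} := by
      intro k
      have h1 : LinearMap.det (ρ ⁅k, l⁆) = 1 := by
        have h2 : ∀ d : K →* ℂ, d ⁅k, l⁆ = 1 := fun d => by
          have hk : d k * d k⁻¹ = 1 := by rw [← map_mul, mul_inv_cancel, map_one]
          have hl : d l * d l⁻¹ = 1 := by rw [← map_mul, mul_inv_cancel, map_one]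
          rw [commutatorElement_def, map_mul, map_mul, map_mul]
          linear_combination d l * d l⁻¹ * hk + hl
        exact h2 ((LinearMap.det : Module.End ℂ V →* ℂ).comp ρ)
      rw [hact, LinearMap.det_smul, map_one, mul_one] at h1
      exact h1
    have hfin : {z : ℂ | z ^ Module.finrank ℂ V = 1}.Finite := by
      refine (Polynomial.nthRoots (Module.finrank ℂ V) (1 : ℂ)).toFinset.finite_toSet.subset ?_
      intro z hz
      simpa [Polynomial.mem_nthRoots Module.finrank_pos] using hz
    have h2 := eq_of_continuous_of_finite hcont hfin hval k 1
    have h3 : χ (c 1) • (1 : Module.End ℂ V) = 1 := by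
      rw [← hact, commutatorElement_one_left, map_one]
    have h4 : ρ ⁅k, l⁆ = 1 := by rw [hact, h2, h3]
    rw [← map_mul, ← map_mul]
    have h5 : k * l = ⁅k, l⁆ * (l * k) := by simp [commutatorElement_def, mul_assoc]
    rw [h5, map_mul, h4, one_mul]
  by_cases hsc : ∀ k, ∃ c : ℂ, ∀ v, ρ k v = c • v
  · exact ⟨v₀, hv₀, fun k => (hsc k).imp fun c hc => hc v₀⟩
  push Not at hsc
  obtain ⟨k, hk⟩ := hsc
  obtain ⟨μ, hμ⟩ := Module.End.exists_eigenvalue (ρ k)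
  refine hsub (Module.End.eigenspace (ρ k) μ) hμ (fun h => ?_) fun l w hw => ?_
  · obtain ⟨v, hv⟩ := hk μ
    exact hv (Module.End.mem_eigenspace_iff.1 (h ▸ Submodule.mem_top))
  · rw [Module.End.mem_eigenspace_iff] at hw ⊢
    rw [← Module.End.mul_apply, hcomm, Module.End.mul_apply, hw, map_smul]

/-- Climbs the derived series from its trivial term up to `G`; each term is connected because `G`
is. -/
theorem hasEigenvectors_of_isSolvable [PreconnectedSpace G] [Group.IsSolvable G] :
    HasEigenvectors G := by
  obtain ⟨d, hd⟩ := Group.IsSolvable.solvable (G := G)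
  have key : ∀ j, j ≤ d → HasEigenvectors (derivedSeries G (d - j)) := by
    intro j
    induction j with
    | zero =>
      intro _ V _ _ _ _ ρ _
      obtain ⟨v, hv⟩ := exists_ne (0 : V)
      refine ⟨v, hv, fun k => ⟨1, ?_⟩⟩
      have : k = 1 := by
        ext
        have h1 : ∀ x : G, x ∈ derivedSeries G (d - 0) → x = 1 := by
          rw [Nat.sub_zero, hd]
          exact fun x hx => hx
        exact h1 _ k.2
      rw [this, map_one, one_smul]
      rfl
    | succ j ih =>
      intro hj
      refine hasEigenvectors_of_commutator (isPreconnected_derivedSeries _) ?_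
      have := ih (by omega)
      rw [show d - j = d - (j + 1) + 1 by omega] at this
      exact this
  have h0 := key d le_rfl
  rw [Nat.sub_self] at h0
  intro V _ _ _ _ ρ hρ
  obtain ⟨v, hv, h⟩ := h0 V (ρ.comp (derivedSeries G 0).subtype)
    fun v f => (hρ v f).comp continuous_subtype_val
  exact ⟨v, hv, fun k => h ⟨k, by simp⟩⟩

omit [IsTopologicalGroup G] in
/-- A group with common eigenvectors that is generated by unipotent elements is unipotent. -/
theorem isNilpotent_sub_one_of_hasEigenvectors (hG : HasEigenvectors G) {T : Set G}
    (hT : Subgroup.closure T = ⊤) (V : Type) [AddCommGroup V] [Module ℂ V] [FiniteDimensional ℂ V]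
    (ρ : G →* Module.End ℂ V) (hρ : IsContinuousRep ρ) (hu : ∀ t ∈ T, IsNilpotent (ρ t - 1))
    (g : G) : IsNilpotent (ρ g - 1) := by
  induction hd : Module.finrank ℂ V using Nat.strong_induction_on generalizing V with
  | _ d ih =>
  rcases subsingleton_or_nontrivial V with hV | hV
  · exact ⟨1, Subsingleton.elim _ _⟩
  obtain ⟨v, hv, hev⟩ := hG V ρ hρ
  -- A unipotent operator has only the eigenvalue 1, so the common eigenvector is fixed by the
  -- generators and then by the group. The induction continues on the quotient by its line.
  have hfixT : ∀ t ∈ T, ρ t v = v := by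
    intro t ht
    obtain ⟨c, hc⟩ := hev t
    obtain ⟨m, hm⟩ := hu t ht
    have h1 : ∀ m : ℕ, ((ρ t - 1) ^ m) v = (c - 1) ^ m • v := by
      intro m
      induction m with
      | zero => simp
      | succ m ih =>
        rw [pow_succ', Module.End.mul_apply, ih, map_smul, LinearMap.sub_apply, hc,
          Module.End.one_apply, pow_succ, mul_smul, sub_smul, one_smul]
    have h2 := h1 m
    rw [hm, LinearMap.zero_apply] at h2
    have h3 : (c - 1) ^ m = 0 := by
      rcases smul_eq_zero.1 h2.symm with h | h
      · exact h
      · exact absurd h hv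
    rw [hc, sub_eq_zero.1 (eq_zero_of_pow_eq_zero h3), one_smul]
  have hfix : ∀ k, ρ k v = v := by
    intro k
    have hk : k ∈ Subgroup.closure T := hT ▸ Subgroup.mem_top k
    induction hk using Subgroup.closure_induction with
    | mem x hx => exact hfixT x hx
    | one => simp
    | mul x y _ _ hx hy => rw [map_mul, Module.End.mul_apply, hy, hx]
    | inv x _ hx =>
      conv_lhs => rw [← hx]
      rw [← Module.End.mul_apply, ← map_mul, inv_mul_cancel, map_one, Module.End.one_apply]
  set W := Submodule.span ℂ {v}
  have hW : ∀ k, ∀ w ∈ W, ρ k w = w := by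
    intro k w hw
    obtain ⟨c, rfl⟩ := Submodule.mem_span_singleton.1 hw
    rw [map_smul, hfix]
  have hW' : ∀ k, ∀ w ∈ W, ρ k w ∈ W := fun k w hw => by rwa [hW k w hw]
  have hq : ∀ (k : G) (m : ℕ) (x : V),
      ((quotientRep ρ W hW' k - 1) ^ m) (W.mkQ x) = W.mkQ (((ρ k - 1) ^ m) x) := by
    intro k m
    induction m with
    | zero => exact fun x => rfl
    | succ m ih =>
      intro x
      rw [pow_succ, pow_succ, Module.End.mul_apply, Module.End.mul_apply, ← ih]
      rfl
  have hlt : Module.finrank ℂ (V ⧸ W) < d := by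
    have h1 := Submodule.finrank_quotient_add_finrank W
    have h2 : Module.finrank ℂ W = 1 := finrank_span_singleton hv
    omega
  obtain ⟨m, hm⟩ := ih _ hlt (V ⧸ W) (quotientRep ρ W hW') (isContinuousRep_quotientRep hρ W hW')
    (fun t ht => by
      obtain ⟨m, hm⟩ := hu t ht
      refine ⟨m, LinearMap.ext fun x => ?_⟩
      obtain ⟨x, rfl⟩ := W.mkQ_surjective x
      rw [hq, hm]
      simp) rfl
  -- The `m`-th power maps into the fixed line `W`, and one more factor kills it.
  refine ⟨m + 1, LinearMap.ext fun x => ?_⟩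
  have h1 : ((ρ g - 1) ^ m) x ∈ W := by
    have := hq g m x
    rw [hm, LinearMap.zero_apply] at this
    exact (Submodule.Quotient.mk_eq_zero W).1 this.symm
  rw [pow_succ', Module.End.mul_apply, LinearMap.sub_apply, hW g _ h1]
  simp

/-- A solvable group of matrices that is generated by a connected set of unipotent matrices is
unipotent. -/
theorem isNilpotent_sub_one_of_mem_closure {ι : Type} [Fintype ι] [DecidableEq ι]
    {T : Set (GL ι ℂ)} (hT : IsPreconnected T) (h1 : (1 : GL ι ℂ) ∈ T)
    (hs : Group.IsSolvable (Subgroup.closure T))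
    (hu : ∀ t ∈ T, IsNilpotent ((t : Matrix ι ι ℂ) - 1)) {g : GL ι ℂ}
    (hg : g ∈ Subgroup.closure T) : IsNilpotent ((g : Matrix ι ι ℂ) - 1) := by
  have : PreconnectedSpace (Subgroup.closure T) :=
    isPreconnected_iff_preconnectedSpace.1 (isPreconnected_subgroup_closure hT h1)
  let ρ : Subgroup.closure T →* Module.End ℂ (ι → ℂ) :=
    ((Matrix.toLinAlgEquiv' (R := ℂ) (n := ι) : Matrix ι ι ℂ →* Module.End ℂ (ι → ℂ)).comp
      (Units.coeHom _)).comp (Subgroup.closure T).subtype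
  have hρ : ∀ k : Subgroup.closure T, ρ k - 1 =
      Matrix.toLinAlgEquiv' (((k : GL ι ℂ) : Matrix ι ι ℂ) - 1) := by
    intro k
    rw [map_sub, map_one]
    rfl
  have hcont : IsContinuousRep ρ := by
    intro v f
    have h2 : Continuous fun k : Subgroup.closure T => ((k : GL ι ℂ) : Matrix ι ι ℂ).mulVec v := by
      have : Continuous fun k : Subgroup.closure T => ((k : GL ι ℂ) : Matrix ι ι ℂ) :=
        Units.continuous_val.comp continuous_subtype_val
      fun_prop
    exact (LinearMap.continuous_of_finiteDimensional f).comp h2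
  have h2 := isNilpotent_sub_one_of_hasEigenvectors hasEigenvectors_of_isSolvable
    (Subgroup.closure_closure_coe_preimage (k := T)) (ι → ℂ) ρ hcont
    (fun t ht => by
      rw [hρ]
      exact (hu t ht).map _) ⟨g, hg⟩
  rw [hρ] at h2
  exact (IsNilpotent.map_iff (Matrix.toLinAlgEquiv' (R := ℂ) (n := ι)).injective).1 h2

end LieKolchin

/-! ### Unipotent formal diffeomorphisms -/

theorem exists_eq_single_add {d : Fin n →₀ ℕ} (hd : d ≠ 0) :
    ∃ (i : Fin n) (d' : Fin n →₀ ℕ), d = Finsupp.single i 1 + d' ∧ d.degree = d'.degree + 1 := by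
  obtain ⟨i, hi⟩ : ∃ i, d i ≠ 0 := by
    by_contra! h
    exact hd (Finsupp.ext h)
  have hle : Finsupp.single i 1 ≤ d := Finsupp.single_le_iff.2 (Nat.one_le_iff_ne_zero.2 hi)
  refine ⟨i, d - Finsupp.single i 1, (add_tsub_cancel_of_le hle).symm, ?_⟩
  conv_lhs => rw [← add_tsub_cancel_of_le hle]
  rw [map_add, Finsupp.degree_single, add_comm]

/-- The exponent of the coordinate function `x_i`. -/
def singleIndex (k : ℕ) (hk : 1 ≤ k) (i : Fin n) : JetIndex n k :=
  ⟨Finsupp.single i 1, by simp, by rwa [Finsupp.degree_single]⟩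

/-- The monomials of degree one are the coordinate functions. -/
def singleEquiv (n : ℕ) : Fin n ≃ JetIndex n 1 :=
  Equiv.ofBijective (singleIndex 1 le_rfl) (by
    constructor
    · intro i j h
      exact Finsupp.single_left_injective one_ne_zero (congrArg Subtype.val h)
    · rintro ⟨d, h0, h1⟩
      obtain ⟨i, d', hd, hdeg⟩ := exists_eq_single_add h0
      have : d' = 0 := (Finsupp.degree_eq_zero_iff d').1 (by omega)
      refine ⟨i, Subtype.ext ?_⟩
      change Finsupp.single i 1 = d
      rw [hd, this, add_zero])

/-- The linear part lists the images of the coordinates in rows, the jet matrix in columns. -/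
theorem linearPart_eq (φ : FormalDiff n) : linearPart φ =
    (Matrix.reindexAlgEquiv ℂ ℂ (singleEquiv n).symm (jetMatrix 1 φ.toLinearMap)).transpose := rfl

theorem isUnipotent_iff (φ : FormalDiff n) :
    IsUnipotent φ ↔ IsNilpotent (jetMatrix 1 φ.toLinearMap - 1) := by
  rw [IsUnipotent, linearPart_eq, ← Matrix.transpose_one, ← Matrix.transpose_sub,
    Matrix.isNilpotent_transpose_iff,
    ← map_one (Matrix.reindexAlgEquiv ℂ ℂ (singleEquiv n).symm), ← map_sub]
  exact IsNilpotent.map_iff (Matrix.reindexAlgEquiv ℂ ℂ (singleEquiv n).symm).injective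

theorem jetMatrix_sub (k : ℕ) (T S : PS n →ₗ[ℂ] PS n) :
    jetMatrix k (T - S) = jetMatrix k T - jetMatrix k S := by
  ext e d
  simp [jetMatrix]

theorem jetMatrix_diffOp_pow (k m : ℕ) (Φ : PS n →ₐ[ℂ] PS n) :
    jetMatrix k (diffOp Φ ^ m) = (jetMatrix k Φ.toLinearMap - 1) ^ m := by
  rw [jetMatrix_pow _ (diffOp_mem_orderFilt Φ), diffOp, jetMatrix_sub, jetMatrix_one]

theorem exists_diffOp_pow_mem_of_isNilpotent {k : ℕ} (hk : 1 ≤ k) (Φ : PS n →ₐ[ℂ] PS n)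
    (h : IsNilpotent (jetMatrix k Φ.toLinearMap - 1)) :
    ∃ N, ∀ f ∈ orderFilt n 1, (diffOp Φ ^ N) f ∈ orderFilt n 2 := by
  obtain ⟨N, hN⟩ := h
  rw [← jetMatrix_diffOp_pow] at hN
  exact ⟨N, fun f hf => orderFilt_anti (by omega) (mem_orderFilt_succ_of_jetMatrix_eq_zero _
    (fun j => diffOp_pow_mem_orderFilt Φ j N) hN hf)⟩

theorem isNilpotent_jetMatrix_sub_one (Φ : PS n →ₐ[ℂ] PS n)
    (hΦ : ∃ N, ∀ f ∈ orderFilt n 1, (diffOp Φ ^ N) f ∈ orderFilt n 2) (k : ℕ) :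
    IsNilpotent (jetMatrix k Φ.toLinearMap - 1) := by
  obtain ⟨N, hN⟩ := exists_diffOp_pow_mem Φ hΦ (k + 1)
  refine ⟨N, ?_⟩
  rw [← jetMatrix_diffOp_pow]
  exact jetMatrix_eq_zero_of_mem _ hN

theorem IsUnipotent.exists_diffOp {φ : FormalDiff n} (hu : IsUnipotent φ) :
    ∃ N, ∀ f ∈ orderFilt n 1, (diffOp (φ : PS n →ₐ[ℂ] PS n) ^ N) f ∈ orderFilt n 2 :=
  exists_diffOp_pow_mem_of_isNilpotent le_rfl _ ((isUnipotent_iff φ).1 hu)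

theorem IsUnipotent.isIterPoly {φ : FormalDiff n} (hu : IsUnipotent φ) :
    IsIterPoly (φ : PS n →ₐ[ℂ] PS n) := isIterPoly_of_diffOp _ hu.exists_diffOp

theorem IsUnipotent.isNilpotent_jet {φ : FormalDiff n} (hu : IsUnipotent φ) (k : ℕ) :
    IsNilpotent (((jet k φ : GL (JetIndex n k) ℂ) : Matrix (JetIndex n k) (JetIndex n k) ℂ) - 1) :=
  isNilpotent_jetMatrix_sub_one _ hu.exists_diffOp k

theorem isUnipotent_of_isNilpotent_jet {φ : FormalDiff n}
    (h : IsNilpotent (((jet 1 φ : GL (JetIndex n 1) ℂ) : Matrix (JetIndex n 1) (JetIndex n 1) ℂ) - 1)) :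
    IsUnipotent φ := (isUnipotent_iff φ).2 h

/-- The complex powers of a unipotent formal diffeomorphism. -/
def IsUnipotent.cpow {φ : FormalDiff n} (hu : IsUnipotent φ) (t : ℂ) : FormalDiff n :=
  complexPowEquiv hu.isIterPoly t

/-- The logarithm of a unipotent formal diffeomorphism. -/
def IsUnipotent.log {φ : FormalDiff n} (hu : IsUnipotent φ) : Derivation ℂ (PS n) (PS n) :=
  logDerivation hu.isIterPoly

theorem IsUnipotent.cpow_one {φ : FormalDiff n} (hu : IsUnipotent φ) : hu.cpow 1 = φ :=
  AlgEquiv.ext fun f => complexPow_one hu.isIterPoly f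

theorem IsUnipotent.cpow_zero {φ : FormalDiff n} (hu : IsUnipotent φ) : hu.cpow 0 = 1 :=
  AlgEquiv.ext fun f => complexPow_zero hu.isIterPoly f

theorem IsUnipotent.cpow_neg {φ : FormalDiff n} (hu : IsUnipotent φ) (t : ℂ) :
    hu.cpow (-t) = (hu.cpow t)⁻¹ := by
  refine eq_inv_of_mul_eq_one_left (AlgEquiv.ext fun f => ?_)
  change complexPow _ (-t) (complexPow _ t f) = f
  rw [← complexPow_add, neg_add_cancel, complexPow_zero]

theorem IsUnipotent.jet_cpow {φ : FormalDiff n} (hu : IsUnipotent φ) (k : ℕ) (t : ℂ) :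
    ((jet k (hu.cpow t) : GL (JetIndex n k) ℂ) : Matrix (JetIndex n k) (JetIndex n k) ℂ) =
      unipotentPow ((jet k φ : GL (JetIndex n k) ℂ) : Matrix (JetIndex n k) (JetIndex n k) ℂ) t :=
  jetMatrix_complexPow hu.isIterPoly (hu.isNilpotent_jet k) t

theorem IsUnipotent.jet_cpow_eq_exp {φ : FormalDiff n} (hu : IsUnipotent φ) (k : ℕ) (t : ℂ) :
    ((jet k (hu.cpow t) : GL (JetIndex n k) ℂ) : Matrix (JetIndex n k) (JetIndex n k) ℂ) =
      NormedSpace.exp (t • unipotentLog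
        ((jet k φ : GL (JetIndex n k) ℂ) : Matrix (JetIndex n k) (JetIndex n k) ℂ)) := by
  rw [hu.jet_cpow, exp_smul_unipotentLog (hu.isNilpotent_jet k)]

theorem IsUnipotent.jetMatrix_log {φ : FormalDiff n} (hu : IsUnipotent φ) (k : ℕ) :
    jetMatrix k (hu.log : PS n →ₗ[ℂ] PS n) = unipotentLog
      ((jet k φ : GL (JetIndex n k) ℂ) : Matrix (JetIndex n k) (JetIndex n k) ℂ) :=
  jetMatrix_logDerivation hu.isIterPoly (hu.isNilpotent_jet k)

theorem isNilpotent_unipotentPow_sub_one {ι : Type*} [Fintype ι] [DecidableEq ι]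
    {g : Matrix ι ι ℂ} (hg : IsNilpotent (g - 1)) (t : ℂ) : IsNilpotent (unipotentPow g t - 1) := by
  have h1 : unipotentPow g t - 1 = (g - 1) * ∑ j ∈ Finset.range (Fintype.card ι + 1),
      (choosePoly (j + 1)).eval t • (g - 1) ^ j := by
    rw [unipotentPow, Finset.sum_range_succ']
    have h0 : (choosePoly 0).eval t = 1 := by simp [choosePoly]
    rw [h0, pow_zero, one_smul, add_sub_cancel_right, Finset.mul_sum]
    refine Finset.sum_congr rfl fun j _ => ?_
    rw [mul_smul_comm, pow_succ']
  rw [h1]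
  refine Commute.isNilpotent_mul_right ?_ hg
  exact Commute.sum_right _ _ _ fun j _ => ((Commute.refl (g - 1)).pow_right j).smul_right _

theorem IsUnipotent.isUnipotent_cpow {φ : FormalDiff n} (hu : IsUnipotent φ) (t : ℂ) :
    IsUnipotent (hu.cpow t) := by
  refine isUnipotent_of_isNilpotent_jet ?_
  rw [hu.jet_cpow]
  exact isNilpotent_unipotentPow_sub_one (hu.isNilpotent_jet 1) t

theorem IsUnipotent.log_mem {φ : FormalDiff n} (hu : IsUnipotent φ) : hu.log ∈ formalVF n :=
  logDerivation_mem hu.isIterPoly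

theorem isUnipotent_conj {φ : FormalDiff n} (hu : IsUnipotent φ) (ψ : FormalDiff n) :
    IsUnipotent (ψ * φ * ψ⁻¹) := by
  refine isUnipotent_of_isNilpotent_jet ?_
  obtain ⟨N, hN⟩ := hu.isNilpotent_jet 1
  refine ⟨N, ?_⟩
  set u := jet 1 ψ
  set g := jet 1 φ
  have h : ((jet 1 (ψ * φ * ψ⁻¹) : GL (JetIndex n 1) ℂ) : Matrix (JetIndex n 1) (JetIndex n 1) ℂ) - 1 =
      (u : Matrix (JetIndex n 1) (JetIndex n 1) ℂ) * ((g : Matrix (JetIndex n 1) (JetIndex n 1) ℂ) - 1) *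
      ((u⁻¹ : GL (JetIndex n 1) ℂ) : Matrix (JetIndex n 1) (JetIndex n 1) ℂ) := by
    rw [mul_sub, sub_mul, mul_one, Units.mul_inv, map_mul, map_mul, map_inv]
    simp [u, g]
  rw [h, Units.conj_pow, hN, mul_zero, zero_mul]

/-! ### Jets of unipotent formal diffeomorphisms -/

/-- The polynomial whose coefficients are the entries of the column `d` of `h`. -/
def columnSeries {k : ℕ} (h : Matrix (JetIndex n k) (JetIndex n k) ℂ) (d : JetIndex n k) : PS n :=
  ∑ c : JetIndex n k, h c d • monomial c.1 (1 : ℂ)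

theorem coeff_columnSeries {k : ℕ} (h : Matrix (JetIndex n k) (JetIndex n k) ℂ) (d e : JetIndex n k) :
    coeff e.1 (columnSeries h d) = h e d := by
  classical
  rw [columnSeries, map_sum, Finset.sum_eq_single e]
  · simp
  · intro c _ hc
    rw [map_smul, coeff_monomial, if_neg (fun h => hc (Subtype.ext h.symm)), smul_zero]
  · simp

theorem columnSeries_mem {k : ℕ} (h : Matrix (JetIndex n k) (JetIndex n k) ℂ) (d : JetIndex n k) :
    columnSeries h d ∈ orderFilt n 1 :=
  Submodule.sum_mem _ fun c _ => Submodule.smul_mem _ _ (monomial_mem_orderFilt_one c.2.1 1)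

theorem sub_columnSeries_mem {k : ℕ} (h : Matrix (JetIndex n k) (JetIndex n k) ℂ) (d : JetIndex n k)
    {f : PS n} (hf : f ∈ orderFilt n 1) (hc : ∀ e : JetIndex n k, coeff e.1 f = h e d) :
    f - columnSeries h d ∈ orderFilt n (k + 1) := by
  intro e he
  by_cases h0 : e = 0
  · subst h0
    exact Submodule.sub_mem _ hf (columnSeries_mem h d) 0 (by simp)
  · have := hc ⟨e, h0, Nat.lt_succ_iff.1 he⟩
    rw [map_sub]
    exact sub_eq_zero.2 (this.trans (coeff_columnSeries h d _).symm)

theorem mul_sub_mul_mem {k : ℕ} {f g f' g' : PS n} (hf : f - f' ∈ orderFilt n k)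
    (hg : g - g' ∈ orderFilt n k) : f * g - f' * g' ∈ orderFilt n k := by
  have h1 : f * g - f' * g' = (f - f') * g + f' * (g - g') := by ring
  rw [h1]
  refine Submodule.add_mem _ (mul_mem_orderFilt hf (mem_orderFilt_zero g)) ?_
  have := mul_mem_orderFilt (mem_orderFilt_zero f') hg
  rwa [zero_add] at this

/-- The multiplicative relations between the columns of the jet of a formal diffeomorphism. -/
theorem coeff_columnSeries_mul_jet {k : ℕ} (φ : FormalDiff n) (s d' d : JetIndex n k)
    (hd : d.1 = s.1 + d'.1) (e : JetIndex n k) :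
    coeff e.1 (columnSeries (jetMatrix k φ.toLinearMap) s *
      columnSeries (jetMatrix k φ.toLinearMap) d') = jetMatrix k φ.toLinearMap e d := by
  have h1 : ∀ c : JetIndex n k, φ (monomial c.1 1) -
      columnSeries (jetMatrix k φ.toLinearMap) c ∈ orderFilt n (k + 1) := fun c =>
    sub_columnSeries_mem _ c (algHom_mem_orderFilt (φ : PS n →ₐ[ℂ] PS n) 1 _
      (monomial_mem_orderFilt_one c.2.1 1)) fun _ => rfl
  have h2 := mul_sub_mul_mem (h1 s) (h1 d') e.1 (Nat.lt_succ_of_le e.2.2)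
  rw [map_sub, sub_eq_zero, ← map_mul, monomial_mul_monomial, one_mul, ← hd] at h2
  rw [← h2]
  rfl

/-- Shows the multiplicative relations to be quadratic in the matrix entries, so that they extend to
Zariski closures. -/
theorem coeff_columnSeries_mul {k : ℕ} (h : Matrix (JetIndex n k) (JetIndex n k) ℂ)
    (s d' e : JetIndex n k) : coeff e.1 (columnSeries h s * columnSeries h d') =
      ∑ c : JetIndex n k, ∑ c' : JetIndex n k,
        coeff e.1 (monomial c.1 (1 : ℂ) * monomial c'.1 (1 : ℂ) : PS n) * (h c s * h c' d') := by
  simp only [columnSeries, Finset.sum_mul, Finset.mul_sum, map_sum, smul_mul_smul_comm, map_smul,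
    smul_eq_mul]
  rw [Finset.sum_comm]
  exact Finset.sum_congr rfl fun c _ => Finset.sum_congr rfl fun c' _ => mul_comm _ _

/-- The multiplicative relations hold on the Zariski closure of any set of jets. -/
theorem coeff_columnSeries_mul_of_mem {k : ℕ} {S : Set (GL (JetIndex n k) ℂ)}
    (hS : S ⊆ (jet (n := n) k).range) {h : GL (JetIndex n k) ℂ} (hh : h ∈ zariskiSet S)
    (s d' d : JetIndex n k) (hd : d.1 = s.1 + d'.1) (e : JetIndex n k) :
    coeff e.1 (columnSeries (h : Matrix (JetIndex n k) (JetIndex n k) ℂ) s *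
      columnSeries (h : Matrix (JetIndex n k) (JetIndex n k) ℂ) d') =
      (h : Matrix (JetIndex n k) (JetIndex n k) ℂ) e d := by
  set P : MvPolynomial (JetIndex n k × JetIndex n k) ℂ :=
    (∑ c : JetIndex n k, ∑ c' : JetIndex n k, MvPolynomial.C (coeff e.1
      (monomial c.1 (1 : ℂ) * monomial c'.1 (1 : ℂ) : PS n)) *
      (MvPolynomial.X (c, s) * MvPolynomial.X (c', d'))) - MvPolynomial.X (e, d) with hP
  have key : ∀ g : Matrix (JetIndex n k) (JetIndex n k) ℂ, entryEval P g =
      coeff e.1 (columnSeries g s * columnSeries g d') - g e d := by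
    intro g
    rw [coeff_columnSeries_mul, hP, entryEval]
    simp only [map_sub, map_sum, map_mul, MvPolynomial.eval_C, MvPolynomial.eval_X]
  rw [← sub_eq_zero, ← key]
  refine hh P fun g hg => ?_
  obtain ⟨φ, rfl⟩ := hS hg
  rw [key, sub_eq_zero]
  exact coeff_columnSeries_mul_jet φ s d' d hd e

/-- A unipotent matrix that satisfies the multiplicative relations is the jet of a formal
diffeomorphism. -/
theorem mem_range_jet {k : ℕ} {S : Set (GL (JetIndex n k) ℂ)}
    (hS : S ⊆ (jet (n := n) k).range) {h : GL (JetIndex n k) ℂ} (hh : h ∈ zariskiSet S)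
    (hu : IsNilpotent ((h : Matrix (JetIndex n k) (JetIndex n k) ℂ) - 1)) :
    h ∈ (jet (n := n) k).range := by
  rcases Nat.eq_zero_or_pos k with rfl | hk
  · refine ⟨1, Units.ext (Matrix.ext fun e => ?_)⟩
    exact absurd ((Finsupp.degree_eq_zero_iff e.1).1 (Nat.le_zero.1 e.2.2)) e.2.1
  set H : Matrix (JetIndex n k) (JetIndex n k) ℂ := (h : Matrix (JetIndex n k) (JetIndex n k) ℂ)
  -- The columns of the coordinates define an endomorphism by substitution; the multiplicative
  -- relations then force all other columns, by induction on the degree.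
  have ha : HasSubst fun i => columnSeries H (singleIndex k hk i) :=
    hasSubst_of_constantCoeff_zero fun i => mem_orderFilt_one.1 (columnSeries_mem H _)
  set Φ : PS n →ₐ[ℂ] PS n := substAlgHom ha
  have hX : ∀ i, Φ (X i) = columnSeries H (singleIndex k hk i) := fun i => substAlgHom_X ha i
  have key : ∀ (m : ℕ) (d : JetIndex n k), d.1.degree = m →
      Φ (monomial d.1 1) - columnSeries H d ∈ orderFilt n (k + 1) := by
    intro m
    induction m with
    | zero => exact fun d hd => absurd ((Finsupp.degree_eq_zero_iff d.1).1 hd) d.2.1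
    | succ m ih =>
      rintro d hm
      obtain ⟨i, d', hd, hdeg⟩ := exists_eq_single_add d.2.1
      by_cases h0 : d' = 0
      · have hd1 : d = singleIndex k hk i := Subtype.ext (by rw [hd, h0, add_zero]; rfl)
        rw [hd1, ← hX, sub_eq_zero.2]
        · exact Submodule.zero_mem _
        · rfl
      · have hk' := d.2.2
        have h1 := mul_sub_mul_mem (ih ⟨d', h0, by omega⟩ (by simp only; omega))
          (show Φ (X i) - columnSeries H (singleIndex k hk i) ∈ orderFilt n (k + 1) by
            rw [hX, sub_self]
            exact Submodule.zero_mem _)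
        rw [← map_mul, mul_comm, X, monomial_mul_monomial, one_mul, ← hd] at h1
        refine sub_columnSeries_mem H d (algHom_mem_orderFilt Φ 1 _
          (monomial_mem_orderFilt_one d.2.1 1)) fun e => ?_
        refine Eq.trans ?_
          (coeff_columnSeries_mul_of_mem hS hh (singleIndex k hk i) ⟨d', h0, by omega⟩ d hd e)
        rw [mul_comm, ← sub_eq_zero, ← map_sub]
        exact h1 e.1 (Nat.lt_succ_of_le e.2.2)
  have hjet : jetMatrix k Φ.toLinearMap = H := by
    ext e d
    have := key _ d rfl e.1 (Nat.lt_succ_of_le e.2.2)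
    rw [map_sub, sub_eq_zero, coeff_columnSeries] at this
    exact this
  -- Invertibility comes from unipotency: `Φ` is its own first complex power, with inverse `Φ ^
  -- (-1)`.
  have hΦ := exists_diffOp_pow_mem_of_isNilpotent hk Φ (by rw [hjet]; exact hu)
  refine ⟨complexPowEquiv (isIterPoly_of_diffOp Φ hΦ) 1, Units.ext ?_⟩
  refine Eq.trans ?_ hjet
  ext e d
  exact congrArg (coeff e.1) (complexPow_one (isIterPoly_of_diffOp Φ hΦ) (monomial d.1 1))

/-! ### Algebraic hulls of jets -/

theorem jet_mem_jetHull {G : Subgroup (FormalDiff n)} {φ : FormalDiff n} (hφ : φ ∈ G) (k : ℕ) :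
    jet k φ ∈ jetHull G k :=
  Subgroup.mem_sInf.2 fun _ hH => hH.2.2 (Subgroup.mem_map_of_mem _ hφ)

/-- Each algebraic group in the intersection contains the power, so algebraicity of the hull itself
is not required. -/
theorem mem_jetHull_of_eq_unipotentPow {G : Subgroup (FormalDiff n)} {k : ℕ}
    {g h : GL (JetIndex n k) ℂ} (hg : g ∈ jetHull G k)
    (hu : IsNilpotent ((g : Matrix (JetIndex n k) (JetIndex n k) ℂ) - 1)) {t : ℂ}
    (h1 : (h : Matrix (JetIndex n k) (JetIndex n k) ℂ) =
      unipotentPow (g : Matrix (JetIndex n k) (JetIndex n k) ℂ) t) : h ∈ jetHull G k :=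
  Subgroup.mem_sInf.2 fun _ hH => hH.1.mem_of_eq_unipotentPow (Subgroup.mem_sInf.1 hg _ hH) hu h1

theorem jetHull_mono {G H : Subgroup (FormalDiff n)} (h : G ≤ H) (k : ℕ) :
    jetHull G k ≤ jetHull H k :=
  sInf_le_sInf fun _ hK => ⟨hK.1, hK.2.1, (Subgroup.map_mono h).trans hK.2.2⟩

/-- The hull is an infimum over groups of jets only, so the Zariski closure is a competitor thanks
to `mem_range_jet`. With `S` as a separate variable, the hull of a Krull closure can be compared
with the jets of the group before closing. -/
theorem jetHull_le_zariskiClosure (G : Subgroup (FormalDiff n)) (k : ℕ)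
    (S : Subgroup (GL (JetIndex n k) ℂ)) (hGS : G.map (jet k) = S)
    (hS : ∀ s ∈ S, IsNilpotent ((s : Matrix (JetIndex n k) (JetIndex n k) ℂ) - 1)) :
    jetHull G k ≤ zariskiClosure S hS := by
  refine sInf_le ⟨isAlgebraic_zariskiClosure S hS, fun h hh => ?_, hGS ▸ le_zariskiClosure S hS⟩
  refine mem_range_jet (S := (S : Set (GL (JetIndex n k) ℂ))) ?_ hh
    (isNilpotent_of_mem_zariskiClosure hh)
  rw [← hGS]
  rintro _ ⟨φ, _, rfl⟩
  exact ⟨φ, rfl⟩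

theorem mem_proAlgClosure {G : Subgroup (FormalDiff n)} {φ : FormalDiff n} :
    φ ∈ proAlgClosure G ↔ ∀ k, jet k φ ∈ jetHull G k := by
  simp [proAlgClosure, Subgroup.mem_iInf]

theorem IsProAlgebraic.cpow_mem {L : Subgroup (FormalDiff n)} (hL : IsProAlgebraic L)
    {φ : FormalDiff n} (hφ : φ ∈ L) (hu : IsUnipotent φ) (t : ℂ) : hu.cpow t ∈ L := by
  rw [hL, mem_proAlgClosure]
  exact fun k => mem_jetHull_of_eq_unipotentPow (jet_mem_jetHull hφ k) (hu.isNilpotent_jet k)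
    (hu.jet_cpow k t)

theorem IsProAlgebraic.log_mem_lieAlgUnipotent {L : Subgroup (FormalDiff n)} (hL : IsProAlgebraic L)
    {φ : FormalDiff n} (hφ : φ ∈ L) (hu : IsUnipotent φ) : hu.log ∈ lieAlgUnipotent L := by
  refine ⟨hu.log_mem, fun k t => ⟨jet k (hu.cpow t),
    ⟨jet_mem_jetHull (hL.cpow_mem hφ hu t) k, (hu.isUnipotent_cpow t).isNilpotent_jet k⟩, ?_⟩⟩
  rw [hu.jet_cpow_eq_exp, hu.jetMatrix_log]

/-! ### The unipotent part of a solvable group -/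

theorem IsUnipotent.continuous_jet_cpow {φ : FormalDiff n} (hu : IsUnipotent φ) (k : ℕ) :
    Continuous fun t => jet k (hu.cpow t) := by
  have h1 : Continuous (unipotentPow
      ((jet k φ : GL (JetIndex n k) ℂ) : Matrix (JetIndex n k) (JetIndex n k) ℂ)) := by
    unfold unipotentPow
    fun_prop
  refine Units.continuous_iff.2 ⟨?_, ?_⟩
  · exact h1.congr fun t => (hu.jet_cpow k t).symm
  · refine (h1.comp continuous_neg).congr fun t => ?_
    rw [Function.comp_apply, ← hu.jet_cpow, hu.cpow_neg, map_inv]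

/-- Complex powers join every unipotent element of `L` to 1 inside `L`. The unipotent linear parts
therefore form a connected set, and the group it generates is solvable, so Lie–Kolchin makes it
unipotent. -/
theorem IsProAlgebraic.isUnipotent_mul {L : Subgroup (FormalDiff n)} (hL : IsProAlgebraic L)
    (hs : Group.IsSolvable L) {φ ψ : FormalDiff n} (hφ : φ ∈ L) (hψ : ψ ∈ L)
    (hφu : IsUnipotent φ) (hψu : IsUnipotent ψ) : IsUnipotent (φ * ψ) := by
  set T : Set (GL (JetIndex n 1) ℂ) := jet 1 '' {u | u ∈ L ∧ IsUnipotent u} with hTdef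
  have h1u : IsUnipotent (1 : FormalDiff n) := by
    refine isUnipotent_of_isNilpotent_jet ?_
    rw [map_one, Units.val_one, sub_self]
    exact IsNilpotent.zero
  have hT : IsPreconnected T := by
    refine isPreconnected_of_forall (jet 1 1) ?_
    rintro _ ⟨u, ⟨hu, huu⟩, rfl⟩
    refine ⟨Set.range fun t => jet 1 (huu.cpow t), ?_, ⟨0, ?_⟩, ⟨1, ?_⟩,
      isPreconnected_range (huu.continuous_jet_cpow 1)⟩
    · rintro _ ⟨t, rfl⟩
      exact ⟨_, ⟨hL.cpow_mem hu huu t, huu.isUnipotent_cpow t⟩, rfl⟩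
    · simp only [huu.cpow_zero]
    · simp only [huu.cpow_one]
  have hle : Subgroup.closure T ≤ L.map (jet 1) := by
    rw [Subgroup.closure_le]
    rintro _ ⟨u, hu, rfl⟩
    exact ⟨u, hu.1, rfl⟩
  have hsol : Group.IsSolvable (Subgroup.closure T) := by
    have : Group.IsSolvable (L.map (jet 1)) :=
      Group.isSolvable_of_surjective ((jet 1).subgroupMap_surjective L)
    exact Group.isSolvable_of_isSolvable_injective (Subgroup.inclusion_injective hle)
  refine isUnipotent_of_isNilpotent_jet ?_
  refine isNilpotent_sub_one_of_mem_closure hT ⟨1, ⟨one_mem L, h1u⟩, map_one _⟩ hsol ?_ ?_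
  · rintro _ ⟨u, hu, rfl⟩
    exact hu.2.isNilpotent_jet 1
  · rw [map_mul]
    exact mul_mem (Subgroup.subset_closure ⟨φ, ⟨hφ, hφu⟩, rfl⟩)
      (Subgroup.subset_closure ⟨ψ, ⟨hψ, hψu⟩, rfl⟩)

theorem IsUnipotent.inv {φ : FormalDiff n} (hu : IsUnipotent φ) : IsUnipotent φ⁻¹ := by
  have := hu.isUnipotent_cpow (-1)
  rwa [hu.cpow_neg, hu.cpow_one] at this

/-- The unipotent part of a solvable pro-algebraic group consists of its unipotent elements. -/
theorem IsProAlgebraic.mem_unipotentPart {L : Subgroup (FormalDiff n)} (hL : IsProAlgebraic L)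
    (hs : Group.IsSolvable L) {φ : L} : φ ∈ unipotentPart L ↔ IsUnipotent (φ : FormalDiff n) := by
  refine ⟨fun h => ?_, fun h => Subgroup.subset_normalClosure h⟩
  have h1u : IsUnipotent (1 : FormalDiff n) := by
    refine isUnipotent_of_isNilpotent_jet ?_
    rw [map_one, Units.val_one, sub_self]
    exact IsNilpotent.zero
  let N : Subgroup L :=
    { carrier := {φ : L | IsUnipotent (φ : FormalDiff n)}
      mul_mem' := fun {a b} ha hb => hL.isUnipotent_mul hs a.2 b.2 ha hb
      one_mem' := h1u
      inv_mem' := fun {a} ha => IsUnipotent.inv ha }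
  have : N.Normal := ⟨fun a ha g => isUnipotent_conj ha g⟩
  exact (Subgroup.normalClosure_le_normal (N := N) fun _ h => h : unipotentPart L ≤ N) h

/-! ### Meromorphic vector fields -/

theorem derivation_fractionRing_ext {D E : Derivation ℂ (MeroField n) (MeroField n)}
    (h : ∀ f : PS n, D (algebraMap (PS n) (MeroField n) f) = E (algebraMap (PS n) (MeroField n) f)) :
    D = E := by
  ext1 x
  obtain ⟨a, b, hb, hx⟩ := exists_eq_div (A := PS n) x
  have hD := congrArg D hx
  have hE := congrArg E hx
  rw [Derivation.leibniz, smul_eq_mul, smul_eq_mul] at hD hE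
  rw [h, h] at hD
  exact mul_left_cancel₀ hb (by linear_combination hD - hE)

theorem extend_algebraMap (Z : Derivation ℂ (PS n) (PS n)) (f : PS n) :
    extend Z (algebraMap (PS n) (MeroField n) f) = algebraMap (PS n) (MeroField n) (Z f) :=
  extendDerivation_algebraMap Z f

theorem fieldAct_algebraMap (φ : FormalDiff n) (f : PS n) :
    fieldAct φ (algebraMap (PS n) (MeroField n) f) = algebraMap (PS n) (MeroField n) (φ f) :=
  IsFractionRing.algEquivOfAlgEquiv_algebraMap φ f

theorem fieldAct_symm_algebraMap (φ : FormalDiff n) (f : PS n) :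
    (fieldAct φ).symm (algebraMap (PS n) (MeroField n) f) =
      algebraMap (PS n) (MeroField n) (φ.symm f) := by
  rw [AlgEquiv.symm_apply_eq, fieldAct_algebraMap, AlgEquiv.apply_symm_apply]

/-- The conjugate `φ ∘ Z ∘ φ⁻¹` of a derivation of the ring of power series. -/
def conjDerivation (φ : FormalDiff n) (Z : Derivation ℂ (PS n) (PS n)) :
    Derivation ℂ (PS n) (PS n) :=
  Derivation.mk' (φ.toLinearMap ∘ₗ (Z : PS n →ₗ[ℂ] PS n) ∘ₗ φ.symm.toLinearMap) (by
    intro f g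
    simp [Derivation.leibniz])

theorem conjDerivation_apply (φ : FormalDiff n) (Z : Derivation ℂ (PS n) (PS n)) (f : PS n) :
    conjDerivation φ Z f = φ (Z (φ.symm f)) := rfl

theorem pullback_apply (φ : FormalDiff n) (D : Derivation ℂ (MeroField n) (MeroField n))
    (x : MeroField n) : pullback φ D x = fieldAct φ (D ((fieldAct φ).symm x)) := rfl

theorem extend_conjDerivation (φ : FormalDiff n) (Z : Derivation ℂ (PS n) (PS n)) :
    extend (conjDerivation φ Z) = pullback φ (extend Z) :=
  derivation_fractionRing_ext fun f => by
    rw [extend_algebraMap, pullback_apply, fieldAct_symm_algebraMap, extend_algebraMap,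
      fieldAct_algebraMap, conjDerivation_apply]

theorem pullback_add (φ : FormalDiff n) (D E : Derivation ℂ (MeroField n) (MeroField n)) :
    pullback φ (D + E) = pullback φ D + pullback φ E := by
  ext1 x
  simp [pullback_apply]

theorem pullback_smul (φ : FormalDiff n) (g : MeroField n)
    (D : Derivation ℂ (MeroField n) (MeroField n)) :
    pullback φ (g • D) = fieldAct φ g • pullback φ D := by
  ext1 x
  simp [pullback_apply]

theorem pullback_sum {α : Type*} (s : Finset α) (φ : FormalDiff n)
    (D : α → Derivation ℂ (MeroField n) (MeroField n)) :
    pullback φ (∑ i ∈ s, D i) = ∑ i ∈ s, pullback φ (D i) := by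
  classical
  induction s using Finset.induction_on with
  | empty =>
    ext1 x
    simp [pullback_apply]
  | insert i s hi ih => rw [Finset.sum_insert hi, Finset.sum_insert hi, pullback_add, ih]

/-- A multiple of a meromorphic vector field is a derivation of the ring of power series. -/
theorem exists_smul_eq_extend {D : Derivation ℂ (MeroField n) (MeroField n)} (hD : D ∈ meroVF n) :
    ∃ q : PS n, q ≠ 0 ∧ ∃ Z, algebraMap (PS n) (MeroField n) q • D = extend Z := by
  induction hD using Submodule.span_induction with
  | mem D h =>
    obtain ⟨Z, -, rfl⟩ := h
    exact ⟨1, one_ne_zero, Z, by rw [map_one, one_smul]⟩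
  | zero => exact ⟨1, one_ne_zero, 0, derivation_fractionRing_ext fun f => by
      simp [extend_algebraMap]⟩
  | add D E _ _ hD hE =>
    obtain ⟨q, hq, Z, hZ⟩ := hD
    obtain ⟨r, hr, W, hW⟩ := hE
    refine ⟨q * r, mul_ne_zero hq hr, r • Z + q • W, derivation_fractionRing_ext fun f => ?_⟩
    have h1 := congrArg (fun D => D (algebraMap (PS n) (MeroField n) f)) hZ
    have h2 := congrArg (fun D => D (algebraMap (PS n) (MeroField n) f)) hW
    simp only [Derivation.smul_apply, smul_eq_mul, extend_algebraMap] at h1 h2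
    simp only [extend_algebraMap, Derivation.smul_apply, Derivation.add_apply, smul_eq_mul, map_mul,
      map_add, ← h1, ← h2]
    ring
  | smul g D _ hD =>
    obtain ⟨q, hq, Z, hZ⟩ := hD
    obtain ⟨a, b, hb, hg⟩ := exists_eq_div (A := PS n) g
    refine ⟨b * q, mul_ne_zero (fun h => hb (by rw [h, map_zero])) hq, a • Z,
      derivation_fractionRing_ext fun f => ?_⟩
    have h1 := congrArg (fun D => D (algebraMap (PS n) (MeroField n) f)) hZ
    simp only [Derivation.smul_apply, smul_eq_mul, extend_algebraMap] at h1
    simp only [extend_algebraMap, Derivation.smul_apply, smul_eq_mul, map_mul, ← h1, ← hg]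
    ring

/-- The components of a derivation. -/
def components (n : ℕ) :
    Derivation ℂ (MeroField n) (MeroField n) →ₗ[MeroField n] (Fin n → MeroField n) where
  toFun D i := D (algebraMap (PS n) (MeroField n) (X i))
  map_add' _ _ := rfl
  map_smul' _ _ := rfl

/-- Membership in `meroVF` permits clearing denominators, which reduces the claim to
`derivation_eq_zero`; an arbitrary derivation of the field is in general not determined by its
values at the coordinates. -/
theorem eq_zero_of_components_eq_zero {D : Derivation ℂ (MeroField n) (MeroField n)}
    (hD : D ∈ meroVF n) (h : components n D = 0) : D = 0 := by
  obtain ⟨q, hq, Z, hZ⟩ := exists_smul_eq_extend hD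
  have hinj := IsFractionRing.injective (PS n) (MeroField n)
  have hZ0 : Z = 0 := derivation_eq_zero fun i => by
    have h1 := congrArg (fun D => D (algebraMap (PS n) (MeroField n) (X i))) hZ
    have h2 : D (algebraMap (PS n) (MeroField n) (X i)) = 0 := congrFun h i
    simp only [Derivation.smul_apply, h2, smul_zero, extend_algebraMap] at h1
    exact hinj (by rw [← h1, map_zero])
  have h0 : extend (0 : Derivation ℂ (PS n) (PS n)) = 0 :=
    derivation_fractionRing_ext fun f => by simp [extend_algebraMap]
  rw [hZ0, h0] at hZ
  refine (smul_eq_zero.1 hZ).resolve_left fun h => hq (hinj ?_)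
  rw [h, map_zero]

/-- The tuples of power series `c` such that `∑ c_i D(x_i) = 0` for all `D` in `V`. -/
def annihilator (V : Submodule (MeroField n) (Derivation ℂ (MeroField n) (MeroField n))) :
    Set (Fin n → PS n) :=
  {c | ∀ D ∈ V, ∑ i, algebraMap (PS n) (MeroField n) (c i) * components n D i = 0}

theorem sum_mul_eq_zero_of_mem_annihilator
    {V : Submodule (MeroField n) (Derivation ℂ (MeroField n) (MeroField n))} {c : Fin n → PS n}
    (hc : c ∈ annihilator V) {Z : Derivation ℂ (PS n) (PS n)} (hZ : extend Z ∈ V) :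
    ∑ i, c i * Z (X i) = 0 := by
  have h1 := hc _ hZ
  apply IsFractionRing.injective (PS n) (MeroField n)
  rw [map_zero, ← h1, map_sum]
  refine Finset.sum_congr rfl fun i _ => ?_
  rw [map_mul]
  exact congrArg _ (extend_algebraMap Z (X i)).symm

/-- A subspace of meromorphic vector fields is cut out by its annihilator. -/
theorem extend_mem_of_annihilator
    {V : Submodule (MeroField n) (Derivation ℂ (MeroField n) (MeroField n))} (hV : V ≤ meroVF n)
    {Z : Derivation ℂ (PS n) (PS n)} (hZ : Z ∈ formalVF n)
    (h : ∀ c ∈ annihilator V, ∑ i, c i * Z (X i) = 0) : extend Z ∈ V := by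
  classical
  by_contra hnot
  have hZm : extend Z ∈ meroVF n := Submodule.subset_span ⟨Z, hZ, rfl⟩
  -- Taking components is injective on `meroVF n`, so a linear form on the space of tuples separates
  -- `Z` from `V`; its denominators are cleared next.
  have h1 : components n (extend Z) ∉ V.map (components n) := by
    rintro ⟨W, hW, hWZ⟩
    refine hnot ?_
    have := eq_zero_of_components_eq_zero (Submodule.sub_mem _ (hV hW) hZm)
      (by rw [map_sub, hWZ, sub_self])
    rwa [← sub_eq_zero.1 this]
  obtain ⟨f, hf, hVf⟩ := Submodule.exists_le_ker_of_notMem h1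
  obtain ⟨q, hq⟩ := IsLocalization.exist_integer_multiples_of_finite (nonZeroDivisors (PS n))
    (fun i : Fin n => f (Pi.single i 1))
  choose c hc using hq
  have hsum : ∀ v : Fin n → MeroField n, ∑ i, algebraMap (PS n) (MeroField n) (c i) * v i =
      algebraMap (PS n) (MeroField n) q * f v := by
    intro v
    have hv : f v = ∑ i, v i * f (Pi.single i 1) := by
      conv_lhs => rw [pi_eq_sum_univ' v]
      rw [map_sum]
      refine Finset.sum_congr rfl fun i _ => ?_
      rw [map_smul, smul_eq_mul]
    rw [hv, Finset.mul_sum]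
    refine Finset.sum_congr rfl fun i _ => ?_
    rw [hc, Algebra.smul_def]
    ring
  have hcV : c ∈ annihilator V := fun D hD => by
    rw [hsum, LinearMap.mem_ker.1 (hVf ⟨D, hD, rfl⟩), mul_zero]
  have h2 := congrArg (algebraMap (PS n) (MeroField n)) (h c hcV)
  rw [map_zero, map_sum] at h2
  have h3 := hsum (components n (extend Z))
  have h4 : ∑ i, algebraMap (PS n) (MeroField n) (c i) * components n (extend Z) i = 0 := by
    rw [← h2]
    refine Finset.sum_congr rfl fun i _ => ?_
    rw [map_mul]
    exact congrArg _ (extend_algebraMap Z (X i))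
  rw [h4] at h3
  rcases mul_eq_zero.1 h3.symm with h5 | h5
  · exact nonZeroDivisors.ne_zero q.2 (IsFractionRing.injective (PS n) (MeroField n)
      (by rw [h5, map_zero]))
  · exact hf h5

/-! ### Functionals on jets -/

theorem columnSeries_add {k : ℕ} (A B : Matrix (JetIndex n k) (JetIndex n k) ℂ) (d : JetIndex n k) :
    columnSeries (A + B) d = columnSeries A d + columnSeries B d := by
  simp [columnSeries, add_smul, Finset.sum_add_distrib]

theorem columnSeries_smul {k : ℕ} (r : ℂ) (A : Matrix (JetIndex n k) (JetIndex n k) ℂ)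
    (d : JetIndex n k) : columnSeries (r • A) d = r • columnSeries A d := by
  simp [columnSeries, mul_smul, Finset.smul_sum]

/-- The functional on jets that maps the jet of `Z` to the coefficient of `∑ c_i Z(x_i)`. -/
def jetFunctional (c : Fin n → PS n) (e : Fin n →₀ ℕ) :
    Matrix (JetIndex n (e.degree + 1)) (JetIndex n (e.degree + 1)) ℂ →ₗ[ℂ] ℂ where
  toFun A := coeff e (∑ i, c i * columnSeries A (singleIndex _ (Nat.le_add_left 1 _) i))
  map_add' A B := by
    simp only [columnSeries_add, mul_add, Finset.sum_add_distrib, map_add]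
  map_smul' r A := by
    simp only [columnSeries_smul, mul_smul_comm, ← Finset.smul_sum, map_smul, RingHom.id_apply]

/-- The column of `x_i` differs from `Z (x_i)` only in degrees at least `deg e + 2`, and multiplying
by `c_i` cannot lower these. Jets of order `deg e + 1` are taken so that the coordinates are among
the indices even for `e = 0`. -/
theorem jetFunctional_jetMatrix (c : Fin n → PS n) (e : Fin n →₀ ℕ)
    {Z : Derivation ℂ (PS n) (PS n)} (hZ : Z ∈ formalVF n) :
    jetFunctional c e (jetMatrix (e.degree + 1) (Z : PS n →ₗ[ℂ] PS n)) =
      coeff e (∑ i, c i * Z (X i)) := by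
  change coeff e (∑ i, c i * columnSeries _ _) = _
  rw [map_sum, map_sum]
  refine Finset.sum_congr rfl fun i _ => ?_
  symm
  rw [← sub_eq_zero, ← map_sub, ← mul_sub]
  have h1 := sub_columnSeries_mem (jetMatrix (e.degree + 1) (Z : PS n →ₗ[ℂ] PS n))
    (singleIndex (e.degree + 1) (Nat.le_add_left 1 _) i)
    (f := Z (X i)) (mem_orderFilt_one.2 (hZ _ (constantCoeff_X i))) fun _ => rfl
  have h2 := mul_mem_orderFilt (mem_orderFilt_zero (c i)) h1
  exact h2 e (by omega)

theorem conjDerivation_mem (φ : FormalDiff n) {Z : Derivation ℂ (PS n) (PS n)}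
    (hZ : Z ∈ formalVF n) : conjDerivation φ Z ∈ formalVF n :=
  fun _ hf => constantCoeff_apply φ (hZ _ (constantCoeff_apply φ.symm hf))

theorem jetMatrix_conjDerivation (k : ℕ) (φ : FormalDiff n) {Z : Derivation ℂ (PS n) (PS n)}
    (hZ : Z ∈ formalVF n) : jetMatrix k (conjDerivation φ Z : PS n →ₗ[ℂ] PS n) =
      ((jet k φ : GL (JetIndex n k) ℂ) : Matrix (JetIndex n k) (JetIndex n k) ℂ) *
        jetMatrix k (Z : PS n →ₗ[ℂ] PS n) *
        (((jet k φ)⁻¹ : GL (JetIndex n k) ℂ) : Matrix (JetIndex n k) (JetIndex n k) ℂ) := by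
  have h1 : (conjDerivation φ Z : PS n →ₗ[ℂ] PS n) = ((φ : PS n →ₐ[ℂ] PS n).toLinearMap ∘ₗ
      (Z : PS n →ₗ[ℂ] PS n)) ∘ₗ (φ.symm : PS n →ₐ[ℂ] PS n).toLinearMap := rfl
  rw [h1, jetMatrix_mul _ _ (fun f hf => algHom_mem_orderFilt (φ : PS n →ₐ[ℂ] PS n) _ _
      (derivation_mem_orderFilt hZ _ f hf)) (algHom_mem_orderFilt (φ.symm : PS n →ₐ[ℂ] PS n) 1),
    jetMatrix_mul _ _ (algHom_mem_orderFilt (φ : PS n →ₐ[ℂ] PS n) _) (derivation_mem_orderFilt hZ 1),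
    ← map_inv]
  rfl

/-! ### Invariant homomorphisms on a normal subgroup -/

open scoped commutatorElement in
/-- If `Γ / N` is cyclic or finite abelian, an additive function on `N` that is invariant under
conjugation by `Γ` vanishes on commutators. -/
theorem commutator_mem_and_eq_zero {Γ : Type*} [Group Γ] {N : Subgroup Γ} [N.Normal]
    (f : N →* Multiplicative ℂ)
    (hf : ∀ (g : Γ) (x : N), f ⟨g * x * g⁻¹, Subgroup.Normal.conj_mem ‹_› _ x.2 g⟩ = f x)
    (hN : IsCyclic (Γ ⧸ N) ∨ (Finite (Γ ⧸ N) ∧ ∀ x y : Γ ⧸ N, x * y = y * x)) (x y : Γ) :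
    ⁅x, y⁆ ∈ f.ker.map N.subtype := by
  set K : Subgroup Γ := f.ker.map N.subtype with hK
  have hmem : ∀ z (hz : z ∈ N), z ∈ K ↔ f ⟨z, hz⟩ = 1 := by
    intro z hz
    constructor
    · rintro ⟨w, hw, rfl⟩
      exact hw
    · exact fun h => ⟨⟨z, hz⟩, h, rfl⟩
  have hKN : K ≤ N := by
    rintro _ ⟨w, _, rfl⟩
    exact w.2
  have hKn : K.Normal := ⟨fun z hz g => by
    rw [hmem _ (Subgroup.Normal.conj_mem ‹_› _ (hKN hz) g), hf g ⟨z, hKN hz⟩]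
    exact (hmem z (hKN hz)).1 hz⟩
  let q := QuotientGroup.mk' K
  -- Invariance of `f` puts `g z g⁻¹ z⁻¹` in the kernel: modulo `K`, the subgroup `N` is central.
  have hcentral : ∀ z ∈ N, ∀ g, q z * q g = q g * q z := by
    intro z hz g
    rw [← map_mul, ← map_mul]
    symm
    rw [← mul_inv_eq_one, ← map_inv, ← map_mul]
    refine (QuotientGroup.eq_one_iff _).2 ?_
    have h1 : g * z * (z * g)⁻¹ = g * z * g⁻¹ * z⁻¹ := by group
    have h2 := Subgroup.Normal.conj_mem ‹N.Normal› _ hz g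
    rw [h1, hmem _ (mul_mem h2 (inv_mem hz))]
    have h3 : (⟨g * z * g⁻¹ * z⁻¹, mul_mem h2 (inv_mem hz)⟩ : N) =
        ⟨g * z * g⁻¹, h2⟩ * (⟨z, hz⟩ : N)⁻¹ := rfl
    rw [h3, map_mul, map_inv, hf g ⟨z, hz⟩, mul_inv_cancel]
  have hcomm : q x * q y = q y * q x := by
    rcases hN with hN | ⟨hfin, hab⟩
    · refine (MonoidHom.isMulCommutative_of_isCyclic_of_ker_le_center
        (QuotientGroup.lift K (QuotientGroup.mk' N) fun z hz =>
          (QuotientGroup.eq_one_iff z).2 (hKN hz)) fun z hz => ?_).is_comm.comm (q x) (q y)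
      obtain ⟨z, rfl⟩ := QuotientGroup.mk'_surjective K z
      rw [Subgroup.mem_center_iff]
      intro g
      obtain ⟨g, rfl⟩ := QuotientGroup.mk'_surjective K g
      exact (hcentral z ((QuotientGroup.eq_one_iff z).1 hz) g).symm
    -- Modulo `K` the commutator `c` is central, so `x ^ m y = c ^ m y x ^ m`. For `m` the order of
    -- `Γ / N`, `x ^ m` is central as well, whence `m f(c) = 0` in `ℂ` and `f(c) = 0`.
    · set c := ⁅x, y⁆ with hc
      have hcN : c ∈ N := by
        rw [← QuotientGroup.eq_one_iff, hc, commutatorElement_def]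
        have := hab (x : Γ ⧸ N) (y : Γ ⧸ N)
        rw [QuotientGroup.mk_mul, QuotientGroup.mk_mul, QuotientGroup.mk_mul, this]
        simp
      have hxy : q x * q y = q c * (q y * q x) := by
        rw [← map_mul, ← map_mul, ← map_mul, hc, commutatorElement_def]
        congr 1
        group
      have hpow : ∀ m : ℕ, q x ^ m * q y = q c ^ m * (q y * q x ^ m) := by
        intro m
        induction m with
        | zero => simp
        | succ m ih =>
          have h1 : q x * q c ^ m = q c ^ m * q x :=
            (Commute.pow_left (hcentral c hcN x) m).symm
          calc q x ^ (m + 1) * q y = q x * (q x ^ m * q y) := by rw [pow_succ', mul_assoc]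
            _ = (q x * q c ^ m) * q y * q x ^ m := by rw [ih]; group
            _ = q c ^ m * (q x * q y) * q x ^ m := by rw [h1]; group
            _ = q c ^ (m + 1) * (q y * q x ^ (m + 1)) := by
              rw [hxy, pow_succ, pow_succ' (q x)]
              group
      set m := Nat.card (Γ ⧸ N) with hm
      have hm0 : m ≠ 0 := Nat.card_pos.ne'
      have hxm : x ^ m ∈ N := by
        rw [← QuotientGroup.eq_one_iff, QuotientGroup.mk_pow, hm, pow_card_eq_one']
      have h2 := hpow m
      rw [← map_pow, hcentral _ hxm] at h2
      have h3 : q (c ^ m) = 1 := by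
        rw [map_pow]
        exact (mul_eq_right.1 h2.symm)
      have h4 : c ^ m ∈ K := (QuotientGroup.eq_one_iff _).1 h3
      rw [hmem _ (pow_mem hcN m)] at h4
      have h5 : f ⟨c, hcN⟩ ^ m = 1 := by
        rw [← map_pow]
        exact h4
      have h6 : (m : ℂ) * (f ⟨c, hcN⟩).toAdd = 0 := by
        have := congrArg Multiplicative.toAdd h5
        rwa [toAdd_pow, toAdd_one, nsmul_eq_mul] at this
      have h7 : f ⟨c, hcN⟩ = 1 := by
        rcases mul_eq_zero.1 h6 with h | h
        · exact absurd (Nat.cast_eq_zero.1 h) hm0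
        · exact Multiplicative.toAdd.injective h
      have h8 : q c = 1 := (QuotientGroup.eq_one_iff _).2 ((hmem c hcN).2 h7)
      rw [hxy, h8, one_mul]
  refine (QuotientGroup.eq_one_iff _).1 ?_
  change q ⁅x, y⁆ = 1
  rw [map_commutatorElement, commutatorElement_eq_one_iff_mul_comm, hcomm]

/-! ### The derived group -/

/-- Conjugation by `φ` changes `Z` by an element of `V`, which the functional attached to an
annihilating tuple does not see. -/
theorem jetFunctional_conj {V : Submodule (MeroField n) (Derivation ℂ (MeroField n) (MeroField n))}
    {c : Fin n → PS n} (hc : c ∈ annihilator V) (e : Fin n →₀ ℕ) {Z : Derivation ℂ (PS n) (PS n)}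
    (hZ : Z ∈ formalVF n) (φ : FormalDiff n)
    (h : extend (conjDerivation φ Z) - extend Z ∈ V) :
    jetFunctional c e (((jet (e.degree + 1) φ : GL (JetIndex n (e.degree + 1)) ℂ) :
        Matrix (JetIndex n (e.degree + 1)) (JetIndex n (e.degree + 1)) ℂ) *
      jetMatrix (e.degree + 1) (Z : PS n →ₗ[ℂ] PS n) *
      (((jet (e.degree + 1) φ)⁻¹ : GL (JetIndex n (e.degree + 1)) ℂ) :
        Matrix (JetIndex n (e.degree + 1)) (JetIndex n (e.degree + 1)) ℂ)) =
      jetFunctional c e (jetMatrix (e.degree + 1) (Z : PS n →ₗ[ℂ] PS n)) := by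
  rw [← jetMatrix_conjDerivation _ φ hZ, jetFunctional_jetMatrix c e (conjDerivation_mem φ hZ),
    jetFunctional_jetMatrix c e hZ, ← sub_eq_zero, ← map_sub, ← Finset.sum_sub_distrib]
  have h1 : extend (conjDerivation φ Z - Z) = extend (conjDerivation φ Z) - extend Z :=
    derivation_fractionRing_ext fun f => by
      rw [Derivation.sub_apply, extend_algebraMap, extend_algebraMap, extend_algebraMap,
        Derivation.sub_apply, map_sub]
  have h2 := sum_mul_eq_zero_of_mem_annihilator hc (h1 ▸ h)
  simp only [Derivation.sub_apply, mul_sub] at h2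
  rw [h2, map_zero]

/-- An `L`-invariant functional on the logarithms of the unipotent elements of `L` vanishes on the
logarithms of the elements of the derived group. -/
theorem IsProAlgebraic.linearMap_log_commutator {L : Subgroup (FormalDiff n)}
    (hL : IsProAlgebraic L) (hs : Group.IsSolvable L) {k : ℕ}
    (Λ : Matrix (JetIndex n k) (JetIndex n k) ℂ →ₗ[ℂ] ℂ)
    (hΛ : ∀ φ ∈ L, ∀ u ∈ L, IsUnipotent u →
      Λ (((jet k φ : GL (JetIndex n k) ℂ) : Matrix (JetIndex n k) (JetIndex n k) ℂ) *
        unipotentLog ((jet k u : GL (JetIndex n k) ℂ) : Matrix (JetIndex n k) (JetIndex n k) ℂ) *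
        (((jet k φ)⁻¹ : GL (JetIndex n k) ℂ) : Matrix (JetIndex n k) (JetIndex n k) ℂ)) =
      Λ (unipotentLog ((jet k u : GL (JetIndex n k) ℂ) :
        Matrix (JetIndex n k) (JetIndex n k) ℂ)))
    (h5 : IsCyclic (L ⧸ unipotentPart L) ∨
      (Finite (L ⧸ unipotentPart L) ∧ ∀ x y : L ⧸ unipotentPart L, x * y = y * x))
    {φ : FormalDiff n} (hφ : φ ∈ ⁅L, L⁆) : ∃ _ : φ ∈ L, IsUnipotent φ ∧
      Λ (unipotentLog ((jet k φ : GL (JetIndex n k) ℂ) :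
        Matrix (JetIndex n k) (JetIndex n k) ℂ)) = 0 := by
  -- The path `u ^ s v` stays in `L` and stays unipotent because products of unipotent elements of
  -- `L` are; these are the hypotheses of additivity.
  have hadd : ∀ u ∈ L, ∀ v ∈ L, IsUnipotent u → IsUnipotent v →
      Λ (unipotentLog ((jet k (u * v) : GL (JetIndex n k) ℂ) :
        Matrix (JetIndex n k) (JetIndex n k) ℂ)) =
      Λ (unipotentLog ((jet k u : GL (JetIndex n k) ℂ) :
        Matrix (JetIndex n k) (JetIndex n k) ℂ)) +
      Λ (unipotentLog ((jet k v : GL (JetIndex n k) ℂ) :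
        Matrix (JetIndex n k) (JetIndex n k) ℂ)) := by
    intro u hu v hv huu hvu
    have h := linearMap_unipotentLog_exp_mul Λ (unipotentLog ((jet k u : GL (JetIndex n k) ℂ) :
        Matrix (JetIndex n k) (JetIndex n k) ℂ)) (fun t => jet k (huu.cpow t))
      (huu.jet_cpow_eq_exp k) (jet k v)
      (fun s => by
        rw [← map_mul]
        exact (hL.isUnipotent_mul hs (hL.cpow_mem hu huu s) hv (huu.isUnipotent_cpow s)
          hvu).isNilpotent_jet k)
      (fun i t => by
        rw [← map_mul, ← map_pow]
        exact hΛ _ (pow_mem (mul_mem (hL.cpow_mem hu huu t) hv) i) u hu huu)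
    rwa [huu.cpow_one, ← map_mul] at h
  have hunip : ∀ u : unipotentPart L, IsUnipotent ((u : L) : FormalDiff n) := fun u =>
    (hL.mem_unipotentPart hs).1 u.2
  let f : unipotentPart L →* Multiplicative ℂ := MonoidHom.mk' (fun u => Multiplicative.ofAdd
      (Λ (unipotentLog ((jet k ((u : L) : FormalDiff n) : GL (JetIndex n k) ℂ) :
        Matrix (JetIndex n k) (JetIndex n k) ℂ))))
    (fun u v => congrArg Multiplicative.ofAdd
      (hadd _ (u : L).2 _ (v : L).2 (hunip u) (hunip v)))
  have hconj : ∀ (g : L) (x : unipotentPart L),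
      f ⟨g * x * g⁻¹, Subgroup.Normal.conj_mem inferInstance _ x.2 g⟩ = f x := by
    intro g x
    refine congrArg Multiplicative.ofAdd ?_
    change Λ (unipotentLog ((jet k ((g : FormalDiff n) * ((x : L) : FormalDiff n) *
      (g : FormalDiff n)⁻¹) : GL (JetIndex n k) ℂ) : Matrix (JetIndex n k) (JetIndex n k) ℂ)) = _
    rw [map_mul, map_mul, map_inv, unipotentLog_conj]
    exact hΛ _ g.2 _ (x : L).2 (hunip x)
  have hle : ⁅L, L⁆ ≤ (f.ker.map (unipotentPart L).subtype).map L.subtype :=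
    Subgroup.commutator_le.2 fun x hx y hy =>
      ⟨_, commutator_mem_and_eq_zero f hconj h5 ⟨x, hx⟩ ⟨y, hy⟩, rfl⟩
  obtain ⟨_, ⟨u, hu, rfl⟩, rfl⟩ := hle hφ
  exact ⟨(u : L).2, hunip u, congrArg Multiplicative.toAdd (MonoidHom.mem_ker.1 hu)⟩

/-- Krull closure adds no jets, so the hull of the closed derived group is controlled by the jets of
`⁅L, L⁆`. -/
theorem map_jet_krullClosure (G : Subgroup (FormalDiff n)) (k : ℕ) :
    (krullClosure G).map (jet k) = G.map (jet k) := by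
  refine le_antisymm ?_ (Subgroup.map_mono fun φ hφ => ?_)
  · rintro _ ⟨φ, hφ, rfl⟩
    exact Subgroup.mem_iInf.1 hφ k
  · exact Subgroup.mem_iInf.2 fun k => Subgroup.mem_map_of_mem _ hφ

end FormalDynamics

end

/-! ### The Lie algebra of the closed derived group -/

open FormalDynamics
theorem mainTheorem9 (n a b : ℕ) (L : Subgroup (FormalDiff n))
    (hsolv : Group.IsSolvable L) (hpro : IsProAlgebraic L)
    (Y : Fin a → Derivation ℂ (MeroField n) (MeroField n))
    (X : Fin b → Derivation ℂ (MeroField n) (MeroField n))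
    (hY : ∀ i, Y i ∈ meroVF n) (hX : ∀ j, X j ∈ meroVF n)
    (hindep : LinearIndependent (MeroField n) (Sum.elim Y X))
    (h1 : ∀ Z ∈ lieAlgUnipotent L,
      extend Z ∈ Submodule.span (MeroField n) (Set.range Y ∪ Set.range X))
    (h2 : ∀ Z ∈ Set.range Y ∪ Set.range X, ∀ W ∈ Set.range Y ∪ Set.range X,
      ⁅Z, W⁆ ∈ Submodule.span (MeroField n) (Set.range Y))
    (h3 : ∀ Z ∈ lieAlgUnipotent L, ∀ (α : Fin a → MeroField n) (β : Fin b → MeroField n),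
      extend Z = ∑ i, α i • Y i + ∑ j, β j • X j →
        ∀ j, (∀ k, Y k (β j) = 0) ∧ (∀ l, X l (β j) = 0) ∧ ∀ φ ∈ L, fieldAct φ (β j) = β j)
    (h4 : ∀ φ ∈ L,
      (∀ k, pullback φ (Y k) ∈ Submodule.span (MeroField n) (Set.range Y)) ∧
      (∀ j, pullback φ (X j) - X j ∈ Submodule.span (MeroField n) (Set.range Y)))
    (h5 : IsCyclic (L ⧸ unipotentPart L) ∨
      (Finite (L ⧸ unipotentPart L) ∧ ∀ x y : L ⧸ unipotentPart L, x * y = y * x)) :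
    (∀ φ ∈ closedDerived L 1, IsUnipotent φ) ∧
      ∀ Z ∈ lieAlg (closedDerived L 1),
        extend Z ∈ Submodule.span (MeroField n) (Set.range Y) ∧ Z ∈ lieAlgUnipotent L := by
  set V := Submodule.span (MeroField n) (Set.range Y) with hV
  have hVm : V ≤ meroVF n := Submodule.span_le.2 (by rintro _ ⟨i, rfl⟩; exact hY i)
  have hM : closedDerived L 1 = krullClosure ⁅L, L⁆ := by
    change krullClosure ⁅proAlgClosure L, proAlgClosure L⁆ = _
    rw [← (hpro : L = proAlgClosure L)]
  have hCL : ⁅L, L⁆ ≤ L := Subgroup.commutator_le.2 fun g hg k hk =>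
    mul_mem (mul_mem (mul_mem hg hk) (inv_mem hg)) (inv_mem hk)
  -- conjugation by `L` is trivial modulo `V`
  have hconj : ∀ φ ∈ L, ∀ Z ∈ lieAlgUnipotent L,
      extend (conjDerivation φ Z) - extend Z ∈ V := by
    intro φ hφ Z hZ
    have hspan := h1 Z hZ
    rw [Submodule.span_union, Submodule.mem_sup] at hspan
    obtain ⟨A, hA, B, hB, hAB⟩ := hspan
    obtain ⟨α, rfl⟩ := (Submodule.mem_span_range_iff_exists_fun _).1 hA
    obtain ⟨β, rfl⟩ := (Submodule.mem_span_range_iff_exists_fun _).1 hB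
    have hβ := h3 Z hZ α β hAB.symm
    -- The `Y`-part stays in `V`. As `φ` fixes `β j`, the term `β j • X j` changes only by `β j •
    -- (φ^* X j - X j)`, again in `V`.
    rw [extend_conjDerivation, ← hAB, pullback_add, pullback_sum, pullback_sum, add_sub_add_comm]
    refine Submodule.add_mem _ (Submodule.sub_mem _ ?_ hA) ?_
    · refine Submodule.sum_mem _ fun i _ => ?_
      rw [pullback_smul]
      exact Submodule.smul_mem _ _ ((h4 φ hφ).1 i)
    · rw [← Finset.sum_sub_distrib]
      refine Submodule.sum_mem _ fun j _ => ?_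
      have hsub : β j • pullback φ (X j) - β j • X j = β j • (pullback φ (X j) - X j) := by
        ext1 x
        simp [mul_sub]
      rw [pullback_smul, (hβ j).2.2 φ hφ, hsub]
      exact Submodule.smul_mem _ _ ((h4 φ hφ).2 j)
  have hC : ∀ c ∈ annihilator V, ∀ (e : Fin n →₀ ℕ), ∀ φ ∈ ⁅L, L⁆, ∃ _ : φ ∈ L, IsUnipotent φ ∧
      jetFunctional c e (unipotentLog ((jet (e.degree + 1) φ : GL (JetIndex n (e.degree + 1)) ℂ) :
        Matrix (JetIndex n (e.degree + 1)) (JetIndex n (e.degree + 1)) ℂ)) = 0 := by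
    intro c hc e φ hφ
    refine hpro.linearMap_log_commutator hsolv (jetFunctional c e) (fun ψ hψ u hu huu => ?_) h5 hφ
    rw [← huu.jetMatrix_log]
    exact jetFunctional_conj hc e huu.log_mem ψ (hconj ψ hψ _ (hpro.log_mem_lieAlgUnipotent hu huu))
  -- The zero tuple annihilates everything; only the unipotency part of `hC` is wanted.
  have hCu : ∀ φ ∈ ⁅L, L⁆, IsUnipotent φ := fun φ hφ =>
    (hC 0 (fun D _ => by simp) 0 φ hφ).2.1
  have hS : ∀ k, ∀ s ∈ (⁅L, L⁆).map (jet k),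
      IsNilpotent ((s : Matrix (JetIndex n k) (JetIndex n k) ℂ) - 1) := by
    rintro k _ ⟨φ, hφ, rfl⟩
    exact (hCu φ hφ).isNilpotent_jet k
  rw [hM]
  have hML : krullClosure ⁅L, L⁆ ≤ L := by
    intro φ hφ
    rw [hpro, mem_proAlgClosure]
    intro k
    obtain ⟨u, hu, huφ⟩ := Subgroup.mem_iInf.1 hφ k
    rw [← huφ]
    exact jet_mem_jetHull (hCL hu) k
  refine ⟨fun φ hφ => isUnipotent_of_isNilpotent_jet
    (hS 1 _ (map_jet_krullClosure ⁅L, L⁆ 1 ▸ Subgroup.mem_map_of_mem _ hφ)), ?_⟩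
  rintro Z ⟨hZ, hZk⟩
  have hle : ∀ k, jetHull (krullClosure ⁅L, L⁆) k ≤ zariskiClosure _ (hS k) := fun k =>
    jetHull_le_zariskiClosure _ k _ (map_jet_krullClosure _ k) (hS k)
  constructor
  · refine extend_mem_of_annihilator hVm hZ fun c hc => MvPowerSeries.ext fun e => ?_
    rw [← jetFunctional_jetMatrix c e hZ, map_zero]
    -- The matrices `exp (t A)` lie in the Zariski closure of the jets of `⁅L, L⁆`, where the
    -- functional vanishes on logarithms; the derivative at `t = 0` gives the claim for `A`.
    refine linearMap_eq_zero_of_unipotentLog_exp _ _ fun t => ?_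
    obtain ⟨h, hh, hexp⟩ := hZk (e.degree + 1) t
    rw [← hexp]
    refine linearMap_unipotentLog_eq_zero_of_mem_zariskiClosure _ ?_ (hle _ hh)
    rintro _ ⟨φ, hφ, rfl⟩
    exact (hC c hc e φ hφ).2.2
  · refine ⟨hZ, fun k t => ?_⟩
    obtain ⟨h, hh, hexp⟩ := hZk k t
    exact ⟨h, ⟨jetHull_mono hML k hh, isNilpotent_of_mem_zariskiClosure (hle k hh)⟩, hexp⟩
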